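/- A finite set $S\subset\mathbb{R}^2$ is in general position if no three of its points are collinear. A geometric graph on $S$ has vertex set $S$ and straight segments between pairs of points of $S$ as edges; it is plane if no two of its edges cross, and biplane if its edge set can be partitioned into the edge sets of two plane graphs on $S$. A biplane graph $(S,E)$ is maximal if there is no biplane graph $(S,E^*)$ with $E\subsetneq E^*$. A triangulation of $S$ is a plane graph on $S$ in which every bounded face is a triangle and the boundary of the outer face is the boundary of the convex hull of $S$. An edge of a triangulation is flippable if it is adjacent to two bounded faces (triangles) whose union is a convex quadrilateral. A graph is $3$-connected if it has more than three vertices and remains connected after the deletion of any set of at most two vertices. Let $S$ be a finite point set in the plane in general position and let $G=(S,E)$ be a maximal biplane graph. (1) If $E=E'\cup E''$ where $T'=(S,E')$ and $T''=(S,E'')$ are triangulations of $S$, then no edge of $E'\cap E''$ is flippable in $T'$, and none is flippable in $T''$. (2) If $|S|\ge 4$, then $G$ is $3$-connected. -/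

import Mathlib

namespace Biplane

/-- The Euclidean plane. -/
abbrev Plane : Type := EuclideanSpace ℝ (Fin 2)

/-- No three distinct points of `S` are collinear. -/
def GeneralPosition (S : Finset Plane) : Prop :=
  ∀ a ∈ S, ∀ b ∈ S, ∀ c ∈ S, a ≠ b → a ≠ c → b ≠ c → ¬ Collinear ℝ ({a, b, c} : Set Plane)

/-- A geometric graph on `S` is a simple graph with vertex set `S`, whose edge `ab` is drawn as
the straight segment between `a` and `b`. It is plane if no two distinct edges cross, that is,
share a point that is interior to both. (In general position, two distinct edges that do not
cross share at most a common endpoint.) -/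
def IsPlane {S : Finset Plane} (G : SimpleGraph S) : Prop :=
  ∀ a b c d : S, G.Adj a b → G.Adj c d → s(a, b) ≠ s(c, d) →
    Disjoint (openSegment ℝ (a : Plane) b) (openSegment ℝ (c : Plane) d)

/-- The edge set can be partitioned into the edge sets of two plane graphs. -/
def IsBiplane {S : Finset Plane} (G : SimpleGraph S) : Prop :=
  ∃ G₁ G₂ : SimpleGraph S, IsPlane G₁ ∧ IsPlane G₂ ∧
    Disjoint G₁.edgeSet G₂.edgeSet ∧ G.edgeSet = G₁.edgeSet ∪ G₂.edgeSet

/-- Edge-maximal in the family of all biplane graphs on `S`; the order on graphs with vertex set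
`S` is inclusion of edge sets. -/
def IsMaximalBiplane {S : Finset Plane} (G : SimpleGraph S) : Prop :=
  Maximal (fun H : SimpleGraph S => IsBiplane H) G

/-- The part of the plane covered by the vertices and edges of the graph. -/
def drawing {S : Finset Plane} (G : SimpleGraph S) : Set Plane :=
  (S : Set Plane) ∪ {x | ∃ a b : S, G.Adj a b ∧ x ∈ segment ℝ (a : Plane) b}

/-- The faces are the connected components of the complement of the drawing. -/
def IsFace {S : Finset Plane} (G : SimpleGraph S) (F : Set Plane) : Prop :=
  ∃ x ∈ (drawing G)ᶜ, F = connectedComponentIn (drawing G)ᶜ x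

/-- `F` is the open region enclosed by three pairwise adjacent vertices. -/
def IsTriangle {S : Finset Plane} (G : SimpleGraph S) (F : Set Plane) : Prop :=
  ∃ a b c : S, G.Adj a b ∧ G.Adj b c ∧ G.Adj a c ∧
    F = interior (convexHull ℝ ({(a : Plane), (b : Plane), (c : Plane)} : Set Plane))

/-- A triangulation of `S`: a plane graph in which all bounded faces are triangles and the boundary
of the outer (unbounded) face is the boundary of the convex hull of `S`. -/
structure IsTriangulation {S : Finset Plane} (T : SimpleGraph S) : Prop where
  plane : IsPlane T
  bounded_face : ∀ F, IsFace T F → Bornology.IsBounded F → IsTriangle T F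
  outer_face : ∀ F, IsFace T F → ¬ Bornology.IsBounded F →
    frontier F = frontier (convexHull ℝ (S : Set Plane))

/-- A convex quadrilateral (as a closed region): the convex hull of four points in convex
position. -/
def IsConvexQuadrilateral (Q : Set Plane) : Prop :=
  ∃ p : Fin 4 → Plane, ConvexIndependent ℝ p ∧ Q = convexHull ℝ (Set.range p)

/-- The edge `ab` is flippable in the triangulation `T`: it is adjacent to two different bounded
faces, and the union of these two (closed) faces is a convex quadrilateral. -/
def IsFlippable {S : Finset Plane} (T : SimpleGraph S) (a b : S) : Prop :=
  T.Adj a b ∧ ∃ F₁ F₂ : Set Plane,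
    IsFace T F₁ ∧ Bornology.IsBounded F₁ ∧ segment ℝ (a : Plane) b ⊆ frontier F₁ ∧
    IsFace T F₂ ∧ Bornology.IsBounded F₂ ∧ segment ℝ (a : Plane) b ⊆ frontier F₂ ∧
    F₁ ≠ F₂ ∧ IsConvexQuadrilateral (closure F₁ ∪ closure F₂)

/-- `k`-connectedness: more than `k` vertices, and deleting any set of fewer than `k` vertices
leaves a connected graph. -/
def IsVertexConnected {V : Type*} [Fintype V] (k : ℕ) (G : SimpleGraph V) : Prop :=
  k < Fintype.card V ∧
    ∀ X : Finset V, X.card < k → (G.induce {v : V | v ∉ X}).Connected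

end Biplane

namespace Biplane

/-! Both claims rest on one contradiction. Write `G` as a union of two plane layers `T₁` and `T₂`,
and let `uv` be an edge of both. If the two triangles of `T₁` at `uv` contain no edge and their
apices `c`, `d` span a segment crossing `uv`, then replacing `uv` by `cd` in `T₁` keeps that layer
plane (`IsPlane.flip`) and loses no edge of the union, since `uv` survives in `T₂`. The edge `cd` is
new, because it crosses an edge of both layers; so `G` was not maximal
(`IsMaximalBiplane.false_of_flip`).

For (1), the faces at a flippable edge are triangles on opposite sides of it. Convexity of their
union forces the segment between the apices through the edge (`IsFlippable.exists_crosses`).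

For (2), take both layers maximal plane and suppose that a set `X` of at most two vertices separates
`A` from `B`. Follow a segment from `A` to `B` through the triangles of a layer. Where the crossed
edges stop touching `A`, there is a crossed edge `uv` inside `X` with one adjacent apex in `A` and
the other in `B` (`exists_crosses_separator`). Since `X` has at most two points, both layers contain
this same edge. Applied once more to the segment between the two apices in `T₁`, the lemma shows
that this segment crosses `uv`, so `uv` can be flipped.

The walk needs only a local form of triangulation: in a maximal plane graph an edge with a point on
its left bounds an empty triangle there (`exists_clear_triangle`). This comes from angular
minimality and visibility, by sign computations with `orient`, without counting edges or studying
faces. -/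

/-! ### Signed areas -/

/-- Twice the signed area of the triangle `abc`. -/
def orient (a b c : Plane) : ℝ := (b 0 - a 0) * (c 1 - a 1) - (b 1 - a 1) * (c 0 - a 0)

lemma orient_swap (a b c : Plane) : orient b a c = -orient a b c := by
  unfold orient; ring

lemma orient_cycle (a b c : Plane) : orient b c a = orient a b c := by
  unfold orient; ring

lemma orient_self_left (a b : Plane) : orient a b a = 0 := by
  unfold orient; ring

lemma orient_self_right (a b : Plane) : orient a b b = 0 := by
  unfold orient; ring

lemma orient_combo (a b x y : Plane) {s t : ℝ} (h : s + t = 1) :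
    orient a b (s • x + t • y) = s * orient a b x + t * orient a b y := by
  obtain rfl : s = 1 - t := by linarith
  simp only [orient, PiLp.add_apply, PiLp.smul_apply, smul_eq_mul]
  ring

lemma orient_sum (a b c w : Plane) :
    orient a b w + orient b c w + orient c a w = orient a b c := by
  unfold orient; ring

/-- Barycentric coordinates, tested against the line `xy`. -/
lemma orient_barycentric (x y p q c w : Plane) :
    orient p q c * orient x y w =
      orient q c w * orient x y p + orient c p w * orient x y q + orient p q w * orient x y c := by
  unfold orient; ring

lemma eq_combo_of_orient_eq_zero {a b c : Plane} (hab : a ≠ b) (h : orient a b c = 0) :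
    ∃ r : ℝ, c = (1 - r) • a + r • b := by
  have hne : (b 0 - a 0) ^ 2 + (b 1 - a 1) ^ 2 ≠ 0 := by
    intro h0
    apply hab
    have h1 : b 0 - a 0 = 0 := by nlinarith [sq_nonneg (b 0 - a 0), sq_nonneg (b 1 - a 1)]
    have h2 : b 1 - a 1 = 0 := by nlinarith [sq_nonneg (b 0 - a 0), sq_nonneg (b 1 - a 1)]
    ext i
    fin_cases i
    · simp; linarith
    · simp; linarith
  -- The coefficient of the orthogonal projection of `c` onto the line `ab`.
  refine ⟨((b 0 - a 0) * (c 0 - a 0) + (b 1 - a 1) * (c 1 - a 1)) /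
    ((b 0 - a 0) ^ 2 + (b 1 - a 1) ^ 2), ?_⟩
  unfold orient at h
  ext i
  fin_cases i
  · simp only [Fin.zero_eta, PiLp.add_apply, PiLp.smul_apply, smul_eq_mul]
    field_simp
    linear_combination (-(b 1 - a 1)) * h
  · simp only [Fin.mk_one, PiLp.add_apply, PiLp.smul_apply, smul_eq_mul]
    field_simp
    linear_combination (b 0 - a 0) * h

/-! ### Consequences of general position -/

section GeneralPosition

variable {S : Finset Plane}

lemma GeneralPosition.orient_ne_zero (hS : GeneralPosition S) {a b c : S}
    (hab : a ≠ b) (hac : a ≠ c) (hbc : b ≠ c) : orient (a : Plane) b c ≠ 0 := by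
  intro h
  refine hS a a.2 b b.2 c c.2 (Subtype.coe_injective.ne hab)
    (Subtype.coe_injective.ne hac) (Subtype.coe_injective.ne hbc) ?_
  obtain ⟨r, hr⟩ := eq_combo_of_orient_eq_zero (fun h' => hab (Subtype.ext h')) h
  rw [collinear_iff_of_mem (p₀ := (a : Plane)) (by simp)]
  refine ⟨(b : Plane) - a, ?_⟩
  intro p hp
  simp only [Set.mem_insert_iff, Set.mem_singleton_iff] at hp
  rcases hp with rfl | rfl | rfl
  · exact ⟨0, by simp⟩
  · exact ⟨1, by simp⟩
  · refine ⟨r, ?_⟩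
    rw [hr, vadd_eq_add]
    module

lemma GeneralPosition.eq_or_eq (hS : GeneralPosition S) {a b c : S}
    (hab : a ≠ b) (h : orient (a : Plane) b c = 0) : c = a ∨ c = b := by
  by_contra! hc
  exact hS.orient_ne_zero hab hc.1.symm hc.2.symm h

/-- Two distinct segments between points in general position that share an interior point cross
properly. -/
lemma GeneralPosition.orient_of_cross (hS : GeneralPosition S) {a b p q : S}
    (hab : a ≠ b) (hpq : p ≠ q) (hne : s(a, b) ≠ s(p, q)) {w : Plane}
    (h1 : w ∈ openSegment ℝ (a : Plane) b) (h2 : w ∈ openSegment ℝ (p : Plane) q) :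
    orient (a : Plane) b p * orient (a : Plane) b q < 0 := by
  obtain ⟨s, t, hs, ht, hst, rfl⟩ := h1
  obtain ⟨s', t', hs', ht', hst', hw⟩ := h2
  have h0 : orient (a : Plane) b (s • (a : Plane) + t • (b : Plane)) = 0 := by
    rw [orient_combo _ _ _ _ hst, orient_self_left, orient_self_right]; ring
  rw [← hw, orient_combo _ _ _ _ hst'] at h0
  by_cases hp : orient (a : Plane) b p = 0
  · have hq : orient (a : Plane) b q = 0 := by
      rw [hp] at h0
      have : t' * orient (a : Plane) b q = 0 := by linarith
      exact (mul_eq_zero.1 this).resolve_left ht'.ne'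
    exfalso
    apply hne
    rcases hS.eq_or_eq hab hp with rfl | rfl <;> rcases hS.eq_or_eq hab hq with rfl | rfl
    · exact absurd rfl hpq
    · rfl
    · exact Sym2.eq_swap
    · exact absurd rfl hpq
  · have : orient (a : Plane) b p * (s' * orient (a : Plane) b p + t' * orient (a : Plane) b q) = 0 := by
      rw [h0, mul_zero]
    have h3 : 0 < orient (a : Plane) b p ^ 2 := by positivity
    have h4 : 0 < s' * orient (a : Plane) b p ^ 2 := by positivity
    have h5 : t' * (orient (a : Plane) b p * orient (a : Plane) b q) < 0 := by nlinarith
    by_contra! h6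
    exact absurd (mul_nonneg ht'.le h6) (not_le.2 h5)

/-- An interior point of a segment between two points of `S` is not in `S`. -/
lemma GeneralPosition.notMem_openSegment (hS : GeneralPosition S) {a b c : S} (hab : a ≠ b) :
    (c : Plane) ∉ openSegment ℝ (a : Plane) b := by
  intro hc
  have hne : (a : Plane) ≠ b := fun h => hab (Subtype.ext h)
  have h0 : orient (a : Plane) b c = 0 := by
    obtain ⟨s, t, hs, ht, hst, h⟩ := hc
    rw [← h, orient_combo _ _ _ _ hst, orient_self_left, orient_self_right]; ring
  rcases hS.eq_or_eq hab h0 with rfl | rfl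
  · exact hne (left_mem_openSegment_iff.1 hc)
  · exact hne (right_mem_openSegment_iff.1 hc)

end GeneralPosition

/-! ### Leaving a triangle, and barycentric coordinates -/

/-- A point common to the two lines `uv` and `cd`, where `u` and `v` are on different sides
of `cd`, is between `u` and `v`. -/
lemma mem_openSegment_of_orient {u v c d w : Plane} (hw : orient u v w = 0)
    (hw' : orient c d w = 0) (hu : 0 < orient c d u) (hv : orient c d v < 0) :
    w ∈ openSegment ℝ u v := by
  have huv : u ≠ v := by rintro rfl; linarith
  obtain ⟨r, rfl⟩ := eq_combo_of_orient_eq_zero huv hw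
  rw [orient_combo _ _ _ _ (by ring)] at hw'
  refine ⟨1 - r, r, ?_, ?_, by ring, rfl⟩
  · by_contra! h
    nlinarith
  · by_contra! h
    nlinarith

/-- A segment that meets the open triangle `f, g, h > 0` and has its ends outside it, meets one of
the sides `f = 0` and `g = 0` away from the side `h = 0`. -/
lemma exists_exit (f₀ f₁ g₀ g₁ h₀ h₁ : ℝ) {t : ℝ} (ht0 : 0 ≤ t) (ht1 : t ≤ 1)
    (hf : 0 < (1 - t) * f₀ + t * f₁) (hg : 0 < (1 - t) * g₀ + t * g₁)
    (hh : 0 < (1 - t) * h₀ + t * h₁)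
    (hz : ¬ (0 < f₀ ∧ 0 < g₀ ∧ 0 < h₀)) (ho : ¬ (0 < f₁ ∧ 0 < g₁ ∧ 0 < h₁)) :
    ∃ s : ℝ, 0 ≤ s ∧ s ≤ 1 ∧ 0 ≤ (1 - s) * f₀ + s * f₁ ∧ 0 ≤ (1 - s) * g₀ + s * g₁ ∧
      0 < (1 - s) * h₀ + s * h₁ ∧
      ((1 - s) * f₀ + s * f₁ = 0 ∨ (1 - s) * g₀ + s * g₁ = 0) := by
  set m : ℝ → ℝ := fun s => min ((1 - s) * f₀ + s * f₁)
    (min ((1 - s) * g₀ + s * g₁) ((1 - s) * h₀ + s * h₁)) with hm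
  have hc : Continuous m := by fun_prop
  have hmt : 0 < m t := by simp [hm, hf, hg, hh]
  have hm0 : m 0 ≤ 0 := by
    by_contra! h
    simp [hm] at h
    tauto
  have hm1 : m 1 ≤ 0 := by
    by_contra! h
    simp [hm] at h
    tauto
  have key : ∀ s, m s = 0 → 0 ≤ (1 - s) * f₀ + s * f₁ ∧ 0 ≤ (1 - s) * g₀ + s * g₁ ∧
      0 ≤ (1 - s) * h₀ + s * h₁ ∧ (0 < (1 - s) * h₀ + s * h₁ →
      ((1 - s) * f₀ + s * f₁ = 0 ∨ (1 - s) * g₀ + s * g₁ = 0)) := by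
    intro s hs
    simp only [hm] at hs
    have h1 := hs.ge
    simp only [le_min_iff] at h1
    refine ⟨h1.1, h1.2.1, h1.2.2, fun h3 => ?_⟩
    by_contra! h4
    have : 0 < min ((1 - s) * f₀ + s * f₁)
      (min ((1 - s) * g₀ + s * g₁) ((1 - s) * h₀ + s * h₁)) := by
      simp only [lt_min_iff]
      exact ⟨lt_of_le_of_ne h1.1 h4.1.symm, lt_of_le_of_ne h1.2.1 h4.2.symm, h3⟩
    linarith
  obtain ⟨s, ⟨hs0, hst⟩, hs⟩ := intermediate_value_Icc ht0 hc.continuousOn ⟨hm0, hmt.le⟩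
  obtain ⟨r, ⟨hr0, hrt⟩, hr⟩ := intermediate_value_Icc' ht1 hc.continuousOn ⟨hm1, hmt.le⟩
  obtain ⟨a1, a2, a3, a4⟩ := key s hs
  obtain ⟨b1, b2, b3, b4⟩ := key r hr
  rcases a3.lt_or_eq with h | h
  · exact ⟨s, hs0, hst.trans ht1, a1, a2, h, a4 h⟩
  rcases b3.lt_or_eq with h' | h'
  · exact ⟨r, ht0.trans hr0, hrt, b1, b2, h', b4 h'⟩
  -- An affine `h` that vanishes at zeros of `m` on both sides of `t` would vanish at `t` too.
  exfalso
  have hsr : s ≠ t := by rintro rfl; linarith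
  have hst' : 0 < t - s := sub_pos.2 (lt_of_le_of_ne hst hsr)
  have e : (r - s) * ((1 - t) * h₀ + t * h₁) = (r - t) * ((1 - s) * h₀ + s * h₁) +
    (t - s) * ((1 - r) * h₀ + r * h₁) := by ring
  rw [← h, ← h'] at e
  have : 0 < (r - s) * ((1 - t) * h₀ + t * h₁) := mul_pos (by linarith) hh
  linarith

/-- The barycentric coordinate of `w` at the vertex `c` of the triangle `abc`. -/
noncomputable def coord (a b c w : Plane) : ℝ := orient a b w / orient a b c

lemma coord_combo (a b c x y : Plane) {s t : ℝ} (h : s + t = 1) :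
    coord a b c (s • x + t • y) = s * coord a b c x + t * coord a b c y := by
  unfold coord
  rw [orient_combo _ _ _ _ h]
  ring

lemma coord_sum {o z r : Plane} (h : orient o z r ≠ 0) (w : Plane) :
    coord z r o w + coord r o z w + coord o z r w = 1 := by
  unfold coord
  rw [show orient z r o = orient o z r from orient_cycle o z r,
    show orient r o z = orient o z r from (orient_cycle r o z).symm]
  field_simp
  rw [← orient_sum o z r w]
  ring

/-! ### Visibility in maximal plane graphs -/

variable {S : Finset Plane}

lemma IsPlane.eq_of_mem {T : SimpleGraph S} (hT : IsPlane T) {a b c d : S} (hab : T.Adj a b)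
    (hcd : T.Adj c d) {w : Plane} (h1 : w ∈ openSegment ℝ (a : Plane) b)
    (h2 : w ∈ openSegment ℝ (c : Plane) d) : s(a, b) = s(c, d) := by
  by_contra hne
  exact Set.disjoint_left.1 (hT a b c d hab hcd hne) h1 h2

/-- A plane graph with one more edge that is not crossed is plane. -/
lemma IsPlane.sup_edge {T : SimpleGraph S} (hT : IsPlane T) {o p : S}
    (h : ∀ a b : S, T.Adj a b → s(a, b) ≠ s(o, p) →
      Disjoint (openSegment ℝ (a : Plane) b) (openSegment ℝ (o : Plane) p)) :
    IsPlane (T ⊔ SimpleGraph.edge o p) := by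
  have seg : ∀ a b : S, s(a, b) = s(o, p) →
      openSegment ℝ (a : Plane) b = openSegment ℝ (o : Plane) p := by
    intro a b hab
    rcases Sym2.eq_iff.1 hab with ⟨rfl, rfl⟩ | ⟨rfl, rfl⟩
    · rfl
    · exact openSegment_symm _ _ _
  have cases : ∀ a b : S, (T ⊔ SimpleGraph.edge o p).Adj a b → T.Adj a b ∨ s(a, b) = s(o, p) := by
    intro a b hab
    rw [SimpleGraph.sup_adj, SimpleGraph.edge_adj] at hab
    rcases hab with hab | hab
    · exact Or.inl hab
    · exact Or.inr (Sym2.eq_iff.2 hab.1)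
  intro a b c d hab hcd hne
  rcases cases a b hab with h1 | h1 <;> rcases cases c d hcd with h2 | h2
  · exact hT a b c d h1 h2 hne
  · rw [seg c d h2]
    exact h a b h1 (h2 ▸ hne)
  · rw [seg a b h1]
    exact (h c d h2 (h1 ▸ hne.symm)).symm
  · exact absurd (h1.trans h2.symm) hne

/-- In a maximal plane graph, two points that see each other are adjacent. -/
lemma adj_of_maximal_isPlane {T : SimpleGraph S} (hT : Maximal IsPlane T) {o p : S} (hop : o ≠ p)
    (h : ∀ a b : S, T.Adj a b → s(a, b) ≠ s(o, p) →
      Disjoint (openSegment ℝ (a : Plane) b) (openSegment ℝ (o : Plane) p)) : T.Adj o p := by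
  have := hT.2 (hT.1.sup_edge h) le_sup_left
  apply this
  rw [SimpleGraph.sup_adj, SimpleGraph.edge_adj]
  exact Or.inr ⟨Or.inl ⟨rfl, rfl⟩, hop⟩

lemma segment_combo {a b w : Plane} {s : ℝ} (h0 : 0 ≤ s) (h1 : s ≤ 1)
    (h : w = (1 - s) • a + s • b) : w ∈ segment ℝ a b :=
  ⟨1 - s, s, by linarith, h0, by ring, h.symm⟩

/-- Let `ozr` be a triangle such that no edge that meets `(o,z] ∪ [z,r)` enters it. The point `p` of
`S` in this triangle that is closest to `oz` in the angular order at `o` is adjacent to `o`, and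
the part of the triangle on the near side of `op` meets no edge. -/
lemma exists_adj_in_triangle (hS : GeneralPosition S) {T : SimpleGraph S}
    (hT : Maximal IsPlane T) (o : S) (z : Plane) (r : S) (hor : orient (o : Plane) z r ≠ 0)
    (H : ∀ a b : S, T.Adj a b → ∀ w ∈ segment ℝ (a : Plane) b,
      0 < coord r o z w → 0 ≤ coord z r o w → 0 ≤ coord o z r w →
      (coord z r o w = 0 ∨ coord o z r w = 0) →
      ∀ w' ∈ openSegment ℝ (a : Plane) b, ¬ (0 < coord z r o w' ∧ 0 < coord o z r w')) :
    ∃ p : S, 0 ≤ coord z r o p ∧ 0 ≤ coord r o z p ∧ 0 < coord o z r p ∧ T.Adj o p ∧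
      (∀ a b : S, T.Adj a b → ∀ w ∈ openSegment ℝ (a : Plane) b,
        ¬ (0 < coord z r o w ∧ 0 < coord o z r w ∧
          0 < coord r o z w * coord o z r p - coord o z r w * coord r o z p)) ∧
      ∀ s : S, ¬ (0 < coord z r o (s : Plane) ∧ 0 < coord o z r (s : Plane) ∧
          0 < coord r o z s * coord o z r p - coord o z r s * coord r o z p) := by
  classical
  set α : Plane → ℝ := coord z r o with hα
  set β : Plane → ℝ := coord r o z with hβ
  set γ : Plane → ℝ := coord o z r with hγ
  have hsum : ∀ w, α w + β w + γ w = 1 := coord_sum hor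
  have αc : ∀ (x y : Plane) {s t : ℝ}, s + t = 1 → α (s • x + t • y) = s * α x + t * α y :=
    fun x y s t => coord_combo _ _ _ x y
  have βc : ∀ (x y : Plane) {s t : ℝ}, s + t = 1 → β (s • x + t • y) = s * β x + t * β y :=
    fun x y s t => coord_combo _ _ _ x y
  have γc : ∀ (x y : Plane) {s t : ℝ}, s + t = 1 → γ (s • x + t • y) = s * γ x + t * γ y :=
    fun x y s t => coord_combo _ _ _ x y
  have αo : α o = 1 := by
    simp only [hα, coord]; exact div_self (by rwa [orient_cycle])
  have βo : β o = 0 := by simp [hβ, coord, orient_self_right]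
  have γo : γ o = 0 := by simp [hγ, coord, orient_self_left]
  have αr : α r = 0 := by simp [hα, coord, orient_self_right]
  have βr : β r = 0 := by simp [hβ, coord, orient_self_left]
  have γr : γ r = 1 := by simp only [hγ, coord]; exact div_self hor
  let C : Finset S := Finset.univ.filter fun s => 0 ≤ α s ∧ 0 ≤ β s ∧ 0 < γ s
  -- Projecting `s` from `o` onto the line `zr` gives a point with coordinate `γ / (β + γ)` at `r`,
  -- so this ratio orders the points by angle from `oz`. The vertex `r` itself is a candidate.
  obtain ⟨p, hpC, hp⟩ := C.exists_min_image (fun s => γ s / (β s + γ s))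
    ⟨r, by simp [C, αr, βr, γr]⟩
  simp only [C, Finset.mem_filter, Finset.mem_univ, true_and] at hpC hp
  obtain ⟨pα, pβ, pγ⟩ := hpC
  have hmin : ∀ s : S, 0 ≤ α s → 0 ≤ β s → 0 < γ s → β s * γ p - γ s * β p ≤ 0 := by
    intro s h1 h2 h3
    have := hp s ⟨h1, h2, h3⟩
    rw [div_le_div_iff₀ (by linarith) (by linarith)] at this
    linarith
  have βpos : ∀ w : Plane, 0 ≤ γ w → 0 < β w * γ p - γ w * β p → 0 < β w := by
    intro w h1 h2
    have : 0 < β w * γ p := by nlinarith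
    exact pos_of_mul_pos_left this pγ.le
  have noS : ∀ s : S, ¬ (0 < α s ∧ 0 < γ s ∧ 0 < β s * γ p - γ s * β p) := by
    rintro s ⟨h1, h2, h3⟩
    exact absurd (hmin s h1.le (βpos s h2.le h3).le h2) (not_le.2 h3)
  -- The functional `β * γ p - γ * β p` vanishes on the line `op` and is positive on the side of
  -- `z`.
  have hc : ∀ (x y : Plane) {s t : ℝ}, s + t = 1 →
      β (s • x + t • y) * γ p - γ (s • x + t • y) * β p =
      s * (β x * γ p - γ x * β p) + t * (β y * γ p - γ y * β p) := by
    intro x y s t h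
    rw [βc x y h, γc x y h]; ring
  have noE : ∀ a b : S, T.Adj a b → ∀ w ∈ openSegment ℝ (a : Plane) b,
        ¬ (0 < α w ∧ 0 < γ w ∧ 0 < β w * γ p - γ w * β p) := by
    rintro a b hab w hw ⟨h1, h2, h3⟩
    have hw' := hw
    obtain ⟨s, t, hs, ht, hst, rfl⟩ := hw
    obtain rfl : s = 1 - t := by linarith
    have e1 := h1
    have e2 := h2
    rw [αc _ _ hst] at h1
    rw [γc _ _ hst] at h2
    rw [hc _ _ hst] at h3
    -- Neither end of the edge is in the region, so the edge leaves it through `zr` or `oz`, at a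
    -- point with `β > 0`; this is what `H` forbids.
    obtain ⟨q, q0, q1, qα, qγ, qh, q'⟩ := exists_exit _ _ _ _ _ _ ht.le (by linarith) h1 h2 h3
      (noS a) (noS b)
    have hq : 1 - q + q = 1 := by ring
    rw [← αc _ _ hq] at qα q'
    rw [← γc _ _ hq] at qγ q'
    rw [← hc _ _ hq] at qh
    exact H a b hab _ (segment_combo q0 q1 rfl) (βpos _ qγ qh) qα qγ q' _ hw' ⟨e1, e2⟩
  refine ⟨p, pα, pβ, pγ, ?_, noE, noS⟩
  have hop : o ≠ p := by
    rintro rfl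
    linarith
  refine adj_of_maximal_isPlane hT hop ?_
  intro a b hab hne
  rw [Set.disjoint_left]
  intro w hw hw'
  have hwp : 0 < α w ∧ 0 < γ w ∧ β w * γ p - γ w * β p = 0 := by
    obtain ⟨s, t, hs, ht, hst, rfl⟩ := hw'
    rw [αc _ _ hst, hc _ _ hst, γc _ _ hst, αo, βo, γo]
    refine ⟨by nlinarith, by nlinarith, by ring⟩
  -- the functional `h` is proportional to `orient o p`
  have hprop : ∀ x : Plane, (β x * γ p - γ x * β p) * orient (o : Plane) z r =
      - orient (o : Plane) p x := by
    intro x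
    have h1 : orient (r : Plane) o z = orient (o : Plane) z r := (orient_cycle _ _ _).symm
    simp only [hβ, hγ, coord, h1]
    field_simp
    unfold orient
    ring
  have hneg := hS.orient_of_cross hop hab.ne hne.symm hw' hw
  -- The ends of an edge crossing `op` are strictly on opposite sides of it, so one is on the side
  -- of `z`.
  have hone : 0 < β (a : Plane) * γ p - γ a * β p ∨ 0 < β (b : Plane) * γ p - γ b * β p := by
    by_contra! hcon
    have := mul_nonneg_of_nonpos_of_nonpos hcon.1 hcon.2
    have h2 := hprop a
    have h3 := hprop b
    have h4 : 0 ≤ (β (a : Plane) * γ p - γ a * β p) * (β (b : Plane) * γ p - γ b * β p) *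
      orient (o : Plane) z r ^ 2 := mul_nonneg this (sq_nonneg _)
    rw [← neg_mul_neg, ← h2, ← h3] at hneg
    linarith
  have main : ∀ a b : S, T.Adj a b → w ∈ openSegment ℝ (a : Plane) b →
      0 < β (a : Plane) * γ p - γ a * β p → False := by
    rintro a b hab ⟨s, t, hs, ht, hst, rfl⟩ ha
    -- A small step from `w` towards `a` enters the region that `noE` shows to be free of edges.
    have hcont : ∀ᶠ ε in nhdsWithin (0 : ℝ) (Set.Ioi 0), ε < t ∧
        0 < s * α a + t * α b + ε * (α a - α b) ∧ 0 < s * γ a + t * γ b + ε * (γ a - γ b) := by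
      apply nhdsWithin_le_nhds
      have c1 : Continuous fun ε : ℝ => s * α a + t * α b + ε * (α a - α b) := by fun_prop
      have c2 : Continuous fun ε : ℝ => s * γ a + t * γ b + ε * (γ a - γ b) := by fun_prop
      rw [αc _ _ hst, γc _ _ hst] at hwp
      filter_upwards [eventually_lt_nhds ht,
        (c1.tendsto 0).eventually (eventually_gt_nhds (by simpa using hwp.1)),
        (c2.tendsto 0).eventually (eventually_gt_nhds (by simpa using hwp.2.1))] with ε e1 e2 e3
      exact ⟨e1, e2, e3⟩
    obtain ⟨ε, ⟨e1, e2, e3⟩, e0⟩ := (hcont.and self_mem_nhdsWithin).exists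
    replace e0 : 0 < ε := e0
    have hst' : (s + ε) + (t - ε) = 1 := by linarith
    refine noE a b hab ((s + ε) • (a : Plane) + (t - ε) • (b : Plane))
      ⟨s + ε, t - ε, by linarith, by linarith, hst', rfl⟩ ⟨?_, ?_, ?_⟩
    · rw [αc _ _ hst']; linarith
    · rw [γc _ _ hst']; linarith
    · have h0 := hwp.2.2
      rw [hc _ _ hst] at h0
      rw [hc _ _ hst']
      set ha' := β (a : Plane) * γ p - γ a * β p
      set hb' := β (b : Plane) * γ p - γ b * β p
      have : t * hb' < 0 := by nlinarith
      have : hb' < 0 := by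
        by_contra! h
        nlinarith
      nlinarith
  rcases hone with h | h
  · exact main a b hab hw h
  · exact main b a hab.symm (by rwa [openSegment_symm]) h

/-! ### Oriented crossings and their order along a segment -/

/-- The segment `ab` crosses `pq`, with `p` and `b` on the left of `ab` and `pq` respectively. -/
structure Crosses (a b p q : Plane) : Prop where
  left : 0 < orient a b p
  right : orient a b q < 0
  ahead : 0 < orient p q b
  behind : orient p q a < 0

/-- The ratio in which the line `pq` divides `ab`. -/
noncomputable def crossRatio (a b p q : Plane) : ℝ := -orient p q a / orient p q b

lemma Crosses.symm {a b p q : Plane} (h : Crosses a b p q) : Crosses b a q p := by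
  obtain ⟨h1, h2, h3, h4⟩ := h
  rw [← neg_pos] at h2 h4
  constructor
  · rw [orient_swap]; exact h2
  · rw [orient_swap]; linarith
  · rw [orient_swap]; exact h4
  · rw [orient_swap]; linarith

lemma crossRatio_symm (a b p q : Plane) :
    crossRatio b a q p = (crossRatio a b p q)⁻¹ := by
  unfold crossRatio
  rw [orient_swap p q a, orient_swap p q b, inv_div, neg_neg, div_neg]

lemma Crosses.crossRatio_pos {a b p q : Plane} (h : Crosses a b p q) : 0 < crossRatio a b p q :=
  div_pos (neg_pos.2 h.behind) h.ahead

/-- The identity `e` makes the value at `b` exceed the value at `a`, so opposite signs can occur in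
one order only. -/
lemma crosses_of_orient {a b p q : Plane} (hp : 0 < orient a b p) (hq : orient a b q < 0)
    (h : orient p q a * orient p q b < 0) : Crosses a b p q := by
  have e : orient p q b - orient p q a = orient a b p - orient a b q := by unfold orient; ring
  have hb : 0 < orient p q b := by
    by_contra! hb
    have : orient p q a < 0 := by linarith
    nlinarith
  exact ⟨hp, hq, hb, by by_contra! ha; nlinarith⟩

lemma GeneralPosition.crosses_of_mem (hS : GeneralPosition S) {a b p q : S}
    (hab : a ≠ b) (hpq : p ≠ q) (hne : s(a, b) ≠ s(p, q)) {w : Plane}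
    (h1 : w ∈ openSegment ℝ (a : Plane) b) (h2 : w ∈ openSegment ℝ (p : Plane) q) :
    Crosses (a : Plane) b p q ∨ Crosses (a : Plane) b q p := by
  have e1 := hS.orient_of_cross hab hpq hne h1 h2
  have e2 := hS.orient_of_cross hpq hab hne.symm h2 h1
  rcases mul_neg_iff.1 e1 with ⟨h3, h4⟩ | ⟨h3, h4⟩
  · exact Or.inl (crosses_of_orient h3 h4 e2)
  · refine Or.inr (crosses_of_orient h4 h3 ?_)
    rw [orient_swap, orient_swap (p : Plane), neg_mul_neg]
    exact e2

lemma orient_eq_zero_of_mem_openSegment {a b w : Plane} (h : w ∈ openSegment ℝ a b) :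
    orient a b w = 0 := by
  obtain ⟨s, t, hs, ht, hst, rfl⟩ := h
  rw [orient_combo _ _ _ _ hst, orient_self_left, orient_self_right]; ring

/-- The crossing point. -/
lemma Crosses.exists_mem {a b p q : Plane} (h : Crosses a b p q) :
    ∃ t, 0 < t ∧ t < 1 ∧ t / (1 - t) = crossRatio a b p q ∧
      (1 - t) • a + t • b ∈ openSegment ℝ p q := by
  have h0 : 0 < orient p q b - orient p q a := by linarith [h.ahead, h.behind]
  have e1 : 1 - -orient p q a / (orient p q b - orient p q a) =
      orient p q b / (orient p q b - orient p q a) := by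
    field_simp; ring
  refine ⟨-orient p q a / (orient p q b - orient p q a), div_pos (by linarith [h.behind]) h0, ?_,
    ?_, ?_⟩
  · rw [div_lt_one h0]; linarith [h.ahead]
  · rw [e1, div_div_div_cancel_right₀ h0.ne', crossRatio]
  · refine mem_openSegment_of_orient (c := a) (d := b) ?_ ?_ h.left h.right
    · rw [orient_combo _ _ _ _ (by ring), e1]
      field_simp
      ring
    · rw [orient_combo _ _ _ _ (by ring), orient_self_left, orient_self_right]; ring

/-- Since `t / (1 - t)` increases with `t`, comparing `crossRatio` compares positions along `ab`. -/
lemma crossRatio_eq {a b p q : Plane} (h : Crosses a b p q) {t : ℝ} (ht : t < 1)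
    (hw : (1 - t) • a + t • b ∈ openSegment ℝ p q) : crossRatio a b p q = t / (1 - t) := by
  have := orient_eq_zero_of_mem_openSegment hw
  rw [orient_combo _ _ _ _ (by ring)] at this
  rw [crossRatio, div_eq_div_iff h.ahead.ne' (by linarith)]
  linarith

/-- Two non-adjacent vertices of a maximal plane graph are separated by a first edge. -/
lemma exists_first_crosses (hS : GeneralPosition S) {T : SimpleGraph S}
    (hT : Maximal IsPlane T) {a b : S} (hab : a ≠ b) (hadj : ¬ T.Adj a b) :
    ∃ p q : S, T.Adj p q ∧ Crosses (a : Plane) b p q ∧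
      ∀ p' q' : S, T.Adj p' q' → Crosses (a : Plane) b p' q' →
        crossRatio (a : Plane) b p q ≤ crossRatio (a : Plane) b p' q' := by
  classical
  let C : Finset (S × S) :=
    Finset.univ.filter fun e => T.Adj e.1 e.2 ∧ Crosses (a : Plane) b e.1 e.2
  have hC : C.Nonempty := by
    by_contra hC
    refine hadj (adj_of_maximal_isPlane hT hab fun p q hpq hne => ?_)
    rw [Set.disjoint_left]
    intro w hw hw'
    rcases hS.crosses_of_mem hab hpq.ne hne.symm hw' hw with h | h
    · exact hC ⟨(p, q), by simp [C, hpq, h]⟩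
    · exact hC ⟨(q, p), by simp [C, hpq.symm, h]⟩
  obtain ⟨e, he, hmin⟩ := C.exists_min_image (fun e => crossRatio (a : Plane) b e.1 e.2) hC
  simp only [C, Finset.mem_filter, Finset.mem_univ, true_and] at he hmin
  exact ⟨e.1, e.2, he.1, he.2, fun p' q' h1 h2 => hmin (p', q') ⟨h1, h2⟩⟩

/-! ### Neighbours on a given side -/

lemma eq_barycentric {o z r : Plane} (h : orient o z r ≠ 0) (w : Plane) :
    w = coord z r o w • o + coord r o z w • z + coord o z r w • r := by
  unfold coord
  rw [show orient z r o = orient o z r from orient_cycle o z r,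
    show orient r o z = orient o z r from (orient_cycle r o z).symm]
  unfold orient at *
  ext i
  fin_cases i
  · simp only [Fin.zero_eta, PiLp.add_apply, PiLp.smul_apply, smul_eq_mul]
    field_simp
    ring
  · simp only [Fin.mk_one, PiLp.add_apply, PiLp.smul_apply, smul_eq_mul]
    field_simp
    ring

lemma eq_or_mem_openSegment {a b w : Plane} (h : w ∈ segment ℝ a b) :
    w = a ∨ w = b ∨ w ∈ openSegment ℝ a b := by
  rw [← insert_endpoints_openSegment] at h
  simpa using h

/-- If `ob` is crossed first at the point `z` of the edge `rs`, and `b` and `r` are on the left of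
`oq`, then `o` has a neighbour on the left of `oq`. -/
lemma exists_adj_left_of_first {T : SimpleGraph S} (hS : GeneralPosition S)
    (hT : Maximal IsPlane T) {o b q r s : S} {z : Plane} (hob : o ≠ b) (hrs : T.Adj r s)
    (hne : s(o, b) ≠ s(r, s)) (hz : z ∈ openSegment ℝ (o : Plane) b)
    (hz' : z ∈ openSegment ℝ (r : Plane) s)
    (hfree : ∀ c d : S, T.Adj c d → ∀ w ∈ openSegment ℝ (o : Plane) z,
      w ∉ openSegment ℝ (c : Plane) d)
    (hb : 0 < orient (o : Plane) q b) (hr : 0 < orient (o : Plane) q r) :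
    ∃ p : S, T.Adj o p ∧ 0 < orient (o : Plane) q p := by
  have hobr : orient (o : Plane) b r ≠ 0 := by
    have := hS.orient_of_cross hob hrs.ne hne hz hz'
    intro h
    rw [h, zero_mul] at this
    exact lt_irrefl _ this
  have hsub : openSegment ℝ (o : Plane) z ⊆ openSegment ℝ (o : Plane) b := by
    obtain ⟨s, t, hs, ht, hst, rfl⟩ := hz
    rintro _ ⟨s', t', hs', ht', hst', rfl⟩
    refine ⟨s' + t' * s, t' * t, by positivity, by positivity, ?_, by module⟩
    rw [add_assoc, ← mul_add, hst, mul_one, hst']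
  have hqz : 0 < orient (o : Plane) q z := by
    obtain ⟨s, t, hs, ht, hst, rfl⟩ := hz
    rw [orient_combo _ _ _ _ hst, orient_self_left]
    nlinarith
  have hozr : orient (o : Plane) z r ≠ 0 := by
    obtain ⟨s, t, hs, ht, hst, rfl⟩ := hz
    rw [orient_cycle (r : Plane) o, orient_combo _ _ _ _ hst, orient_self_right, mul_zero,
      zero_add, ← orient_cycle (r : Plane) o b]
    exact mul_ne_zero ht.ne' hobr
  obtain ⟨p, pα, pβ, pγ, hop, -, -⟩ := exists_adj_in_triangle hS hT o z r hozr (by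
    intro a c hac w hw wβ wα wγ h0 w' hw' ⟨w'α, w'γ⟩
    -- The edge `rs` itself lies on the line `α = 0`. Any other edge meeting the side `zr` would
    -- contradict planarity, and one meeting `oz` would contradict `hfree`.
    by_cases hers : s(a, c) = s(r, s)
    · have αr : coord z r o r = 0 := by simp [coord, orient_self_right]
      have αz : coord z r o z = 0 := by simp [coord, orient_self_left]
      obtain ⟨x, y, hx, hy, hxy, h⟩ := hz'
      have αs : coord z r o s = 0 := by
        have e : coord z r o (x • (r : Plane) + y • (s : Plane)) = 0 := by rw [h, αz]
        rw [coord_combo _ _ _ _ _ hxy, αr, mul_zero, zero_add] at e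
        exact (mul_eq_zero.1 e).resolve_left hy.ne'
      have αac : coord z r o a = 0 ∧ coord z r o c = 0 := by
        rcases Sym2.eq_iff.1 hers with ⟨rfl, rfl⟩ | ⟨rfl, rfl⟩
        · exact ⟨αr, αs⟩
        · exact ⟨αs, αr⟩
      obtain ⟨x', y', -, -, hxy', rfl⟩ := hw'
      rw [coord_combo _ _ _ _ _ hxy', αac.1, αac.2] at w'α
      simp at w'α
    have hbar := eq_barycentric hozr w
    have hsum := coord_sum hozr w
    have on_rs : w ∉ openSegment ℝ (r : Plane) s := by
      intro hwrs
      rcases eq_or_mem_openSegment hw with rfl | rfl | hw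
      · exact hS.notMem_openSegment hrs.ne hwrs
      · exact hS.notMem_openSegment hrs.ne hwrs
      · exact hers (hT.1.eq_of_mem hac hrs hw hwrs)
    by_cases hα : coord z r o w = 0
    · apply on_rs
      rw [hα] at hbar hsum
      obtain ⟨x, y, hx, hy, hxy, rfl⟩ := hz'
      set β := coord (r : Plane) o (x • (r : Plane) + y • (s : Plane)) w
      set γ := coord (o : Plane) (x • (r : Plane) + y • (s : Plane)) r w
      refine ⟨β * x + γ, β * y, by positivity, by positivity, ?_, ?_⟩
      · rw [add_right_comm, ← mul_add, hxy]; linarith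
      · rw [hbar]; module
    · have hγ := h0.resolve_left hα
      rw [hγ, zero_smul, add_zero] at hbar
      have hoz : w ∈ openSegment ℝ (o : Plane) z :=
        ⟨_, _, lt_of_le_of_ne wα (Ne.symm hα), wβ, by linarith, hbar.symm⟩
      rcases eq_or_mem_openSegment hw with rfl | rfl | hw
      · exact hS.notMem_openSegment hob (hsub hoz)
      · exact hS.notMem_openSegment hob (hsub hoz)
      · exact hfree a c hac w hoz hw)
  refine ⟨p, hop, ?_⟩
  have hbar := orient_barycentric (o : Plane) q o z r p
  have e : orient (o : Plane) q p = coord (r : Plane) o z p * orient (o : Plane) q z +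
      coord (o : Plane) z r p * orient (o : Plane) q r := by
    have h1 : orient (r : Plane) o z = orient (o : Plane) z r := (orient_cycle _ _ _).symm
    unfold coord
    rw [h1]
    field_simp
    rw [orient_self_left] at hbar
    linarith
  rw [e]
  have := mul_nonneg pβ hqz.le
  have := mul_pos pγ hr
  linarith

/-- A vertex `p` has a neighbour on the left of `pq` as soon as there is a point on this side. -/
lemma exists_adj_left {T : SimpleGraph S} (hS : GeneralPosition S)
    (hT : Maximal IsPlane T) {p q b : S} (hb : 0 < orient (p : Plane) q b) :
    ∃ c : S, T.Adj p c ∧ 0 < orient (p : Plane) q c := by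
  by_cases hadj : T.Adj p b
  · exact ⟨b, hadj, hb⟩
  have hpb : p ≠ b := by
    rintro rfl
    rw [orient_self_left] at hb
    exact lt_irrefl _ hb
  obtain ⟨r, s, hrs, hcr, hmin⟩ := exists_first_crosses hS hT hpb hadj
  obtain ⟨t, t0, t1, ht, hz⟩ := hcr.exists_mem
  set z : Plane := (1 - t) • (p : Plane) + t • (b : Plane) with hzdef
  have hzpb : z ∈ openSegment ℝ (p : Plane) b := ⟨1 - t, t, by linarith, t0, by ring, rfl⟩
  have hne : s(p, b) ≠ s(r, s) := by
    intro h
    rcases Sym2.eq_iff.1 h with ⟨rfl, rfl⟩ | ⟨rfl, rfl⟩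
    · exact hadj hrs
    · exact hadj hrs.symm
  have hfree : ∀ c d : S, T.Adj c d → ∀ w ∈ openSegment ℝ (p : Plane) z,
      w ∉ openSegment ℝ (c : Plane) d := by
    have key : ∀ c d : S, T.Adj c d → Crosses (p : Plane) b c d →
        ∀ w ∈ openSegment ℝ (p : Plane) z, w ∉ openSegment ℝ (c : Plane) d := by
      rintro c d hcd hc w ⟨x, y, hx, hy, hxy, rfl⟩ hw
      -- On `pb` the point has parameter `y * t < t`, hence a crossing there would precede the first
      -- one.
      have h1 : x • (p : Plane) + y • z = (1 - y * t) • (p : Plane) + (y * t) • (b : Plane) := by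
        obtain rfl : x = 1 - y := by linarith
        rw [hzdef]; module
      rw [h1] at hw
      have hyt : y * t < t := by nlinarith
      have h2 := crossRatio_eq hc (by linarith) hw
      have h3 := hmin c d hcd hc
      rw [h2, ← ht, div_le_div_iff₀ (by linarith) (by linarith)] at h3
      nlinarith
    intro c d hcd w hw hw'
    have hwpb : w ∈ openSegment ℝ (p : Plane) b := by
      obtain ⟨x, y, hx, hy, hxy, rfl⟩ := hw
      refine ⟨x + y * (1 - t), y * t, by nlinarith, by positivity, by linarith, ?_⟩
      rw [hzdef]; module
    have hne' : s(p, b) ≠ s(c, d) := by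
      intro h
      rcases Sym2.eq_iff.1 h with ⟨rfl, rfl⟩ | ⟨rfl, rfl⟩
      · exact hadj hcd
      · exact hadj hcd.symm
    rcases hS.crosses_of_mem hpb hcd.ne hne' hwpb hw' with h | h
    · exact key c d hcd h w hw hw'
    · exact key d c hcd.symm h w hw (by rwa [openSegment_symm])
  have hqz : 0 < orient (p : Plane) q z := by
    rw [hzdef, orient_combo _ _ _ _ (by ring), orient_self_left]
    nlinarith
  -- As `z` is on the left of `pq` and between `r` and `s`, so is at least one of `r` and `s`.
  by_cases hr : 0 < orient (p : Plane) q r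
  · exact exists_adj_left_of_first hS hT hpb hrs hne hzpb hz hfree hb hr
  · refine exists_adj_left_of_first (s := r) hS hT hpb hrs.symm (by rwa [Sym2.eq_swap (a := s)])
      hzpb (by rwa [openSegment_symm]) hfree hb ?_
    obtain ⟨x, y, hx, hy, hxy, h⟩ := hz
    rw [← h, orient_combo _ _ _ _ hxy] at hqz
    by_contra! hs
    nlinarith

/-! ### Empty triangles at an edge -/

/-- The open triangle `pqc`, for `c` on the left of `pq`. -/
def openTriangle (p q c : Plane) : Set Plane :=
  {w | 0 < orient p q w ∧ 0 < orient q c w ∧ 0 < orient c p w}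

lemma openTriangle_cycle (p q c : Plane) : openTriangle q c p = openTriangle p q c := by
  ext w
  simp only [openTriangle, Set.mem_ofPred_eq]
  tauto

/-- No edge enters the open triangle `pqc`. -/
def IsClear (T : SimpleGraph S) (p q c : Plane) : Prop :=
  ∀ a b : S, T.Adj a b → Disjoint (openSegment ℝ (a : Plane) b) (openTriangle p q c)

lemma IsClear.cycle {T : SimpleGraph S} {p q c : Plane} (h : IsClear T p q c) :
    IsClear T q c p := by
  unfold IsClear
  rwa [openTriangle_cycle]

/-- Among the vertices on the left of `pq`, an angularly closest one to `q` as seen from `p`. -/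
lemma exists_min_angle (p q : Plane) (C : Finset S) (hC : C.Nonempty)
    (h : ∀ c ∈ C, 0 < orient p q (c : Plane)) :
    ∃ c ∈ C, ∀ d ∈ C, 0 ≤ orient p (c : Plane) (d : Plane) := by
  -- Dot product over cross product: the cotangent of the angle at `p`, which decreases on the open
  -- half-plane.
  obtain ⟨c, hc, hmax⟩ := C.exists_max_image (fun w =>
    ((q 0 - p 0) * ((w : Plane) 0 - p 0) + (q 1 - p 1) * ((w : Plane) 1 - p 1)) /
      orient p q (w : Plane)) hC
  refine ⟨c, hc, fun d hd => ?_⟩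
  have h1 := hmax d hd
  have hcp := h c hc
  rw [div_le_div_iff₀ (h d hd) hcp] at h1
  have hpos : 0 < (q 0 - p 0) ^ 2 + (q 1 - p 1) ^ 2 := by
    by_contra! h0
    have e1 : q 0 - p 0 = 0 := by nlinarith [sq_nonneg (q 0 - p 0), sq_nonneg (q 1 - p 1)]
    have e2 : q 1 - p 1 = 0 := by nlinarith [sq_nonneg (q 0 - p 0), sq_nonneg (q 1 - p 1)]
    unfold orient at hcp
    rw [e1, e2] at hcp
    simp at hcp
  have e : ((q 0 - p 0) ^ 2 + (q 1 - p 1) ^ 2) * orient p (c : Plane) (d : Plane) =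
    ((q 0 - p 0) * ((c : Plane) 0 - p 0) + (q 1 - p 1) * ((c : Plane) 1 - p 1)) *
      orient p q (d : Plane) -
    ((q 0 - p 0) * ((d : Plane) 0 - p 0) + (q 1 - p 1) * ((d : Plane) 1 - p 1)) *
      orient p q (c : Plane) := by
    unfold orient; ring
  exact nonneg_of_mul_nonneg_right (by linarith) hpos

/-- In a maximal plane graph, an edge with a point of `S` on its left bounds an empty triangle on
this side. -/
lemma exists_clear_triangle {T : SimpleGraph S} (hS : GeneralPosition S)
    (hT : Maximal IsPlane T) {p q b : S} (hpq : T.Adj p q) (hb : 0 < orient (p : Plane) q b) :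
    ∃ c : S, T.Adj p c ∧ T.Adj q c ∧ 0 < orient (p : Plane) q c ∧ IsClear T p q c ∧
      ∀ s : S, (s : Plane) ∉ openTriangle p q c := by
  classical
  obtain ⟨c₀, hc₀⟩ := exists_adj_left hS hT hb
  obtain ⟨c, hc, hmin⟩ := exists_min_angle (p : Plane) q
    (Finset.univ.filter fun c : S => T.Adj p c ∧ 0 < orient (p : Plane) q c)
    ⟨c₀, by simpa using hc₀⟩ (fun c hc => by simp at hc; exact hc.2)
  simp only [Finset.mem_filter, Finset.mem_univ, true_and] at hc hmin
  obtain ⟨hpc, hqc⟩ := hc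
  have hqpc : orient (q : Plane) p c < 0 := by rw [orient_swap]; linarith
  have hpcq : orient (p : Plane) c q < 0 := by rw [orient_cycle]; exact hqpc
  have hcqp : orient (c : Plane) q p < 0 := by rw [orient_cycle, orient_cycle]; exact hqpc
  have hpc' : p ≠ c := hpc.ne
  have αneg : ∀ w : Plane, 0 < coord p c q w ↔ orient (p : Plane) c w < 0 := fun w => by
    unfold coord
    rw [div_pos_iff]
    constructor
    · rintro (h | h)
      · linarith
      · exact h.1
    · exact fun h => Or.inr ⟨h, hpcq⟩
  have γneg : ∀ w : Plane, 0 < coord q p c w ↔ 0 < orient (p : Plane) q w := fun w => by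
    unfold coord
    rw [div_pos_iff, orient_swap p q w]
    constructor
    · rintro (h | h) <;> linarith
    · exact fun h => Or.inr ⟨by linarith, hqpc⟩
  have βneg : ∀ w : Plane, 0 < coord c q p w ↔ 0 < orient (q : Plane) c w := fun w => by
    unfold coord
    rw [div_pos_iff, orient_swap q c w]
    constructor
    · rintro (h | h) <;> linarith
    · exact fun h => Or.inr ⟨by linarith, hcqp⟩
  have αp : coord p c q p = 0 := by simp [coord, orient_self_left]
  have αc : coord p c q c = 0 := by simp [coord, orient_self_right]
  have γp : coord q p c p = 0 := by simp [coord, orient_self_right]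
  have γq : coord q p c q = 0 := by simp [coord, orient_self_left]
  have hno : ∀ e : S, T.Adj p e → 0 < coord p c q e → 0 < coord q p c e → False := by
    intro e hpe h1 h2
    exact absurd (hmin e ⟨hpe, (γneg _).1 h2⟩) (not_le.2 ((αneg _).1 h1))
  have hend : ∀ e : S, T.Adj p e → ∀ w ∈ openSegment ℝ (p : Plane) e,
      ¬ (0 < coord p c q w ∧ 0 < coord q p c w) := by
    rintro e hpe w ⟨x, y, hx, hy, hxy, rfl⟩ ⟨h1, h2⟩
    rw [coord_combo _ _ _ _ _ hxy, αp, mul_zero, zero_add] at h1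
    rw [coord_combo _ _ _ _ _ hxy, γp, mul_zero, zero_add] at h2
    exact hno e hpe (pos_of_mul_pos_right h1 hy.le) (pos_of_mul_pos_right h2 hy.le)
  -- The hypothesis of `exists_adj_in_triangle` with `o = q`, `z = p`, `r = c`. An edge meeting the
  -- interior of `pq` or `pc` is that edge, by planarity; an edge from `p` into the triangle would
  -- beat the minimal angle of `c`.
  have H : ∀ a b : S, T.Adj a b → ∀ w ∈ segment ℝ (a : Plane) b,
      0 < coord c q p w → 0 ≤ coord p c q w → 0 ≤ coord q p c w →
      (coord p c q w = 0 ∨ coord q p c w = 0) →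
      ∀ w' ∈ openSegment ℝ (a : Plane) b, ¬ (0 < coord p c q w' ∧ 0 < coord q p c w') := by
    intro a e hae w hw wβ wα wγ h0 w' hw' hw'pos
    have hbar := eq_barycentric hqpc.ne w
    have hsum := coord_sum hqpc.ne w
    have notp : w ≠ p := by
      rintro rfl
      rcases eq_or_mem_openSegment hw with h | h | h
      · obtain rfl := Subtype.ext h
        exact hend e hae w' hw' hw'pos
      · obtain rfl := Subtype.ext h
        exact hend a hae.symm w' (by rwa [openSegment_symm]) hw'pos
      · exact hS.notMem_openSegment hae.ne h
    have zero_of : ∀ f g : S, s(a, e) = s(f, g) → ∀ k : Plane → ℝ, (∀ (x y : Plane) {s t : ℝ},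
        s + t = 1 → k (s • x + t • y) = s * k x + t * k y) → k f = 0 → k g = 0 → k w' = 0 := by
      intro f g hfg k hk hf hg
      have : k a = 0 ∧ k e = 0 := by
        rcases Sym2.eq_iff.1 hfg with ⟨rfl, rfl⟩ | ⟨rfl, rfl⟩
        · exact ⟨hf, hg⟩
        · exact ⟨hg, hf⟩
      obtain ⟨x, y, -, -, hxy, rfl⟩ := hw'
      rw [hk _ _ hxy, this.1, this.2]; ring
    have on_edge : ∀ f g : S, T.Adj f g → w ∈ openSegment ℝ (f : Plane) g →
        s(a, e) = s(f, g) := by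
      intro f g hfg h
      rcases eq_or_mem_openSegment hw with rfl | rfl | hw
      · exact absurd h (hS.notMem_openSegment hfg.ne)
      · exact absurd h (hS.notMem_openSegment hfg.ne)
      · exact hT.1.eq_of_mem hae hfg hw h
    by_cases hα : coord p c q w = 0
    · by_cases hγ : coord q p c w = 0
      · rw [hα, hγ] at hbar hsum
        apply notp
        rw [hbar, show coord (c : Plane) q p w = 1 by linarith]
        simp
      · have hwo : w ∈ openSegment ℝ (p : Plane) c := by
          refine ⟨_, _, wβ, lt_of_le_of_ne wγ (Ne.symm hγ), by linarith, ?_⟩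
          conv_rhs => rw [hbar, hα]
          simp
        have := zero_of p c (on_edge p c hpc hwo) (coord p c q)
          (fun x y s t h => coord_combo _ _ _ x y h) αp αc
        linarith [hw'pos.1]
    · have hγ := h0.resolve_left hα
      have hwo : w ∈ openSegment ℝ (q : Plane) p := by
        refine ⟨_, _, lt_of_le_of_ne wα (Ne.symm hα), wβ, by linarith, ?_⟩
        conv_rhs => rw [hbar, hγ]
        simp
      have := zero_of q p (on_edge q p hpq.symm hwo) (coord q p c)
        (fun x y s t h => coord_combo _ _ _ x y h) γq γp
      linarith [hw'pos.2]
  obtain ⟨d, dα, dβ, dγ, hqd, hE, hP⟩ := exists_adj_in_triangle hS hT q p c hqpc.ne H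
  have βp : coord c q p p = 1 := div_self hcqp.ne
  have βc : coord c q p c = 0 := by simp [coord, orient_self_left]
  have γc : coord q p c c = 1 := div_self hqpc.ne
  -- Otherwise `pd` runs inside the part free of edges, so `p` sees `d` and is adjacent to it, at a
  -- smaller angle than `c`.
  have hdc : d = c := by
    by_contra hdc
    have hpd : p ≠ d := by
      rintro rfl
      rw [γp] at dγ
      exact lt_irrefl _ dγ
    have dα' : 0 < coord p c q d := by
      refine lt_of_le_of_ne dα (Ne.symm fun h => ?_)
      rw [coord, div_eq_zero_iff] at h
      rcases hS.eq_or_eq hpc' (h.resolve_right hpcq.ne) with h | h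
      · exact hpd h.symm
      · exact hdc h
    refine hno d (adj_of_maximal_isPlane hT hpd fun a e hae _ => ?_) dα' dγ
    rw [Set.disjoint_left]
    rintro w hw ⟨x, y, hx, hy, hxy, rfl⟩
    refine hE a e hae _ hw ⟨?_, ?_, ?_⟩
    · rw [coord_combo _ _ _ _ _ hxy, αp]
      have := mul_pos hy dα'
      linarith
    · rw [coord_combo _ _ _ _ _ hxy, γp]
      have := mul_pos hy dγ
      linarith
    · rw [coord_combo _ _ _ _ _ hxy, coord_combo _ _ _ _ _ hxy, γp, βp]
      have := mul_pos hx dγ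
      nlinarith
  subst hdc
  have tri : ∀ w ∈ openTriangle (p : Plane) q d, 0 < coord p d q w ∧ 0 < coord q p d w ∧
      0 < coord d q p w * coord q p d d - coord q p d w * coord d q p d := by
    rintro w ⟨h1, h2, h3⟩
    rw [βc, γc, mul_one, mul_zero, sub_zero]
    refine ⟨(αneg w).2 ?_, (γneg w).2 h1, (βneg w).2 h2⟩
    rw [orient_swap] at h3
    linarith
  refine ⟨d, hpc, hqd, hqc, fun a e hae => ?_, fun s hs => hP s (tri s hs)⟩
  exact Set.disjoint_left.2 fun w hw hw' => hE a e hae w hw (tri w hw')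

/-! ### Walking along a segment through the triangles -/

/-- A segment `ab` that crosses the edge `pq` of a maximal plane graph ends in the apex of the
triangle on the far side of `pq`, or crosses another side of this triangle further along. -/
lemma exists_next_crosses {T : SimpleGraph S} (hS : GeneralPosition S)
    (hT : Maximal IsPlane T) {a b p q : S} (hab : a ≠ b) (hpq : T.Adj p q)
    (hc : Crosses (a : Plane) b p q) :
    ∃ c : S, T.Adj p c ∧ T.Adj q c ∧ 0 < orient (p : Plane) q c ∧ IsClear T p q c ∧
      (c = b ∨
        (Crosses (a : Plane) b c q ∧
          crossRatio (a : Plane) b p q < crossRatio (a : Plane) b c q) ∨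
        (Crosses (a : Plane) b p c ∧
          crossRatio (a : Plane) b p q < crossRatio (a : Plane) b p c)) := by
  obtain ⟨c, hpc, hqc, hpqc, hclear, hempty⟩ := exists_clear_triangle hS hT hpq hc.ahead
  refine ⟨c, hpc, hqc, hpqc, hclear, ?_⟩
  obtain ⟨h1, h2, h3, h4⟩ := hc
  by_cases hcb : c = b
  · exact Or.inl hcb
  refine Or.inr ?_
  have hca : c ≠ a := by
    rintro rfl
    linarith
  have hbar := orient_barycentric (a : Plane) b p q c b
  rw [orient_self_right, mul_zero] at hbar
  rcases lt_or_gt_of_ne (hS.orient_ne_zero hab hca.symm (Ne.symm hcb)) with h | h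
  · right
    have hpb : p ≠ b := by rintro rfl; rw [orient_self_right] at h1; exact lt_irrefl _ h1
    have hcpb : orient (c : Plane) p b < 0 := by
      refine lt_of_le_of_ne (not_lt.1 fun h' => ?_) (hS.orient_ne_zero hpc.ne.symm hcb hpb)
      -- Were `b` not beyond `pc`, the barycentric identity `hbar` would place it inside the empty
      -- triangle.
      refine hempty b ⟨h3, ?_, h'⟩
      have e1 := mul_neg_of_pos_of_neg h3 h
      have e2 := mul_neg_of_pos_of_neg h' h2
      exact pos_of_mul_pos_left (b := orient (a : Plane) b p) (by linarith) h1.le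
    have hpcb : 0 < orient (p : Plane) c b := by rw [orient_swap]; linarith
    have plucker : orient (p : Plane) c b * orient (p : Plane) q a -
        orient (p : Plane) c a * orient (p : Plane) q b =
        orient (p : Plane) q c * orient (a : Plane) b p := by
      unfold orient; ring
    have e1 := mul_pos hpqc h1
    have e2 := mul_neg_of_pos_of_neg hpcb h4
    have hpca : orient (p : Plane) c a < 0 := by
      by_contra! h'
      have := mul_nonneg h' h3.le
      linarith
    refine ⟨⟨h1, h, hpcb, hpca⟩, ?_⟩
    rw [crossRatio, crossRatio, div_lt_div_iff₀ h3 hpcb]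
    linarith
  · left
    have hqb : q ≠ b := by rintro rfl; rw [orient_self_right] at h2; exact lt_irrefl _ h2
    have hqcb : orient (q : Plane) c b < 0 := by
      refine lt_of_le_of_ne (not_lt.1 fun h' => ?_) (hS.orient_ne_zero hqc.ne hqb hcb)
      refine hempty b ⟨h3, h', ?_⟩
      have e1 := mul_pos h3 h
      have e2 := mul_pos h' h1
      exact pos_of_mul_neg_right (a := orient (a : Plane) b q) (by linarith) h2.le
    have hcqb : 0 < orient (c : Plane) q b := by rw [orient_swap]; linarith
    have plucker : orient (c : Plane) q b * orient (p : Plane) q a -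
        orient (c : Plane) q a * orient (p : Plane) q b =
        - orient (p : Plane) q c * orient (a : Plane) b q := by
      unfold orient; ring
    have e1 := mul_neg_of_pos_of_neg hpqc h2
    have e2 := mul_neg_of_pos_of_neg hcqb h4
    have hcqa : orient (c : Plane) q a < 0 := by
      by_contra! h'
      have := mul_nonneg h' h3.le
      linarith
    refine ⟨⟨h, h2, hcqb, hcqa⟩, ?_⟩
    rw [crossRatio, crossRatio, div_lt_div_iff₀ h3 hcqb]
    linarith

/-- If the vertex set `X` separates `A` from `B` in a maximal plane graph, then every segment from
`A` to `B` crosses an edge inside `X` whose adjacent triangles have apices in `A` and `B`. -/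
lemma exists_crosses_separator {T : SimpleGraph S} (hS : GeneralPosition S)
    (hT : Maximal IsPlane T) {A B X : Set S} (hcover : ∀ s, s ∈ A ∨ s ∈ B ∨ s ∈ X)
    (hX : ∀ x ∈ X, ∀ y ∈ X, ∀ z ∈ X, x ≠ y → z = x ∨ z = y)
    (hAB : ∀ a ∈ A, ∀ b ∈ B, ¬ T.Adj a b) {a b : S} (hne : a ≠ b) (ha : a ∈ A) (hb : b ∈ B) :
    ∃ u ∈ X, ∃ v ∈ X, T.Adj u v ∧ Crosses (a : Plane) b u v ∧
      (∃ c ∈ A, 0 < orient (v : Plane) u c ∧ IsClear T v u c) ∧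
      ∃ d ∈ B, 0 < orient (u : Plane) v d ∧ IsClear T u v d := by
  classical
  have inX : ∀ s : S, s ∉ A → s ∉ B → s ∈ X := fun s h1 h2 =>
    ((hcover s).resolve_left h1).resolve_left h2
  suffices h : ∃ u ∈ X, ∃ v ∈ X, T.Adj u v ∧ Crosses (a : Plane) b u v ∧
      (∃ c ∈ A, 0 < orient (v : Plane) u c ∧ IsClear T v u c) ∧
      ∀ u' v' : S, T.Adj u' v' → Crosses (a : Plane) b u' v' →
        crossRatio (a : Plane) b u v < crossRatio (a : Plane) b u' v' → u' ∉ A ∧ v' ∉ A by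
    -- If no later crossed edge touches `A`, the apex `d` beyond `uv` is not in `A`; nor is it in
    -- `X`, which has no room besides `u` and `v`.
    obtain ⟨u, hu, v, hv, huv, hc, hA, hlast⟩ := h
    refine ⟨u, hu, v, hv, huv, hc, hA, ?_⟩
    obtain ⟨d, hud, hvd, huvd, hclear, hd⟩ := exists_next_crosses hS hT hne huv hc
    refine ⟨d, ?_, huvd, hclear⟩
    by_contra hdB
    have hdA : d ∉ A := by
      rcases hd with rfl | ⟨h1, h2⟩ | ⟨h1, h2⟩
      · exact absurd hb hdB
      · exact (hlast _ _ hvd.symm h1 h2).1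
      · exact (hlast _ _ hud h1 h2).2
    rcases hX u hu v hv d (inX d hdA hdB) huv.ne with rfl | rfl
    · exact hud.ne rfl
    · exact hvd.ne rfl
  let C : Finset (S × S) := Finset.univ.filter fun e =>
    T.Adj e.1 e.2 ∧ Crosses (a : Plane) b e.1 e.2 ∧ (e.1 ∈ A ∨ e.2 ∈ A)
  rcases C.eq_empty_or_nonempty with hC | hC
  · have hnone : ∀ u v : S, T.Adj u v → Crosses (a : Plane) b u v → u ∉ A ∧ v ∉ A := by
      intro u v huv hc
      by_contra h
      have : (u, v) ∈ C := by
        simp only [C, Finset.mem_filter, Finset.mem_univ, true_and]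
        exact ⟨huv, hc, by tauto⟩
      rw [hC] at this
      exact absurd this (Finset.notMem_empty _)
    -- No crossed edge touches `A`. Walking back from the first one crosses nothing, so the triangle
    -- behind it has apex `a`; its other corners are neighbours of `a`, hence in `X`.
    obtain ⟨p, q, hpq, hc, hmin⟩ := exists_first_crosses hS hT hne (hAB a ha b hb)
    obtain ⟨c, hqc, hpc, hqpc, hclear, h⟩ := exists_next_crosses hS hT hne.symm hpq.symm hc.symm
    obtain rfl : c = a := by
      have back : ∀ r s : S, T.Adj r s → Crosses (b : Plane) a s r →
          crossRatio (b : Plane) a q p < crossRatio (b : Plane) a s r → False := by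
        intro r s hrs h1 h2
        rw [crossRatio_symm (a : Plane) b p q, crossRatio_symm (a : Plane) b r s] at h2
        have h3 := hmin r s hrs h1.symm
        have h4 := inv_anti₀ hc.crossRatio_pos h3
        linarith
      rcases h with h | ⟨h1, h2⟩ | ⟨h1, h2⟩
      · exact h
      · exact (back _ _ hpc h1 h2).elim
      · exact (back _ _ hqc.symm h1 h2).elim
    have hpA := hnone p q hpq hc
    exact ⟨p, inX p hpA.1 fun h => hAB c ha p h hpc.symm,
      q, inX q hpA.2 fun h => hAB c ha q h hqc.symm, hpq, hc, ⟨c, ha, hqpc, hclear⟩,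
      fun u' v' h1 h2 _ => hnone u' v' h1 h2⟩
  -- Take the last crossed edge touching `A`. The next crossed edge avoids `A`, but both its ends
  -- are neighbours of a vertex of `A`, so they are in `X`.
  · obtain ⟨e, he, hmax⟩ := C.exists_max_image (fun e => crossRatio (a : Plane) b e.1 e.2) hC
    obtain ⟨p, q⟩ := e
    simp only [C, Finset.mem_filter, Finset.mem_univ, true_and] at he hmax
    obtain ⟨hpq, hc, hA⟩ := he
    have hlast : ∀ u v : S, T.Adj u v → Crosses (a : Plane) b u v →
        crossRatio (a : Plane) b p q < crossRatio (a : Plane) b u v → u ∉ A ∧ v ∉ A := by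
      intro u v huv h1 h2
      by_contra h
      have := hmax (u, v) ⟨huv, h1, by tauto⟩
      simp only at this
      linarith
    obtain ⟨c, hpc, hqc, hpqc, hclear, h⟩ := exists_next_crosses hS hT hne hpq hc
    rcases h with rfl | ⟨h1, h2⟩ | ⟨h1, h2⟩
    · rcases hA with hA | hA
      · exact absurd hpc (hAB p hA c hb)
      · exact absurd hqc (hAB q hA c hb)
    · obtain ⟨hcA, hqA⟩ := hlast _ _ hqc.symm h1 h2
      have hpA := hA.resolve_right hqA
      refine ⟨c, inX c hcA fun h => hAB p hpA c h hpc, q, inX q hqA fun h => hAB p hpA q h hpq,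
        hqc.symm, h1, ⟨p, hpA, ?_, hclear.cycle⟩,
        fun u v huv h3 h4 => hlast u v huv h3 (h2.trans h4)⟩
      rwa [orient_cycle]
    · obtain ⟨hpA, hcA⟩ := hlast _ _ hpc h1 h2
      have hqA := hA.resolve_left hpA
      refine ⟨p, inX p hpA fun h => hAB q hqA p h hpq.symm, c, inX c hcA fun h => hAB q hqA c h hqc,
        hpc, h1, ⟨q, hqA, ?_, hclear.cycle.cycle⟩,
        fun u v huv h3 h4 => hlast u v huv h3 (h2.trans h4)⟩
      rwa [orient_cycle, orient_cycle]

/-! ### Flips and separators in maximal biplane graphs -/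

/-- Shared edges are assigned to the first layer, so the layers may overlap; this allows working
with two maximal plane layers. -/
lemma IsPlane.isBiplane_sup {T₁ T₂ : SimpleGraph S} (h₁ : IsPlane T₁) (h₂ : IsPlane T₂) :
    IsBiplane (T₁ ⊔ T₂) := by
  refine ⟨T₁, T₂ \ T₁, h₁, fun a b c d hab hcd => h₂ a b c d hab.1 hcd.1, ?_, ?_⟩
  · rw [SimpleGraph.edgeSet_sdiff]
    exact Set.disjoint_sdiff_right
  · rw [SimpleGraph.edgeSet_sup, SimpleGraph.edgeSet_sdiff, Set.union_sdiff_self]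

lemma IsPlane.not_crosses {T : SimpleGraph S} (hT : IsPlane T) {c d u v : S} (hcd : T.Adj c d)
    (huv : T.Adj u v) : ¬ Crosses (c : Plane) d u v := by
  intro h
  obtain ⟨t, t0, t1, -, hw⟩ := h.exists_mem
  have := hT.eq_of_mem hcd huv ⟨1 - t, t, by linarith, t0, by ring, rfl⟩ hw
  have h1 := h.left
  rcases Sym2.eq_iff.1 this with ⟨rfl, rfl⟩ | ⟨rfl, rfl⟩
  · rw [orient_self_left] at h1
    exact lt_irrefl _ h1
  · rw [orient_self_right] at h1
    exact lt_irrefl _ h1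

/-- If the triangles adjacent to `uv` have crossing diagonals `uv` and `cd`, then replacing `uv` by
`cd` gives a plane graph. -/
lemma IsPlane.flip {T : SimpleGraph S} (hT : IsPlane T) {u v c d : S} (huv : T.Adj u v)
    (h : Crosses (c : Plane) d u v) (hd : IsClear T u v d) (hc : IsClear T v u c) :
    IsPlane (T.deleteEdges {s(u, v)} ⊔ SimpleGraph.edge c d) := by
  have hdel : IsPlane (T.deleteEdges {s(u, v)}) := fun a b a' b' h1 h2 =>
    hT a b a' b' (T.deleteEdges_le _ h1) (T.deleteEdges_le _ h2)
  refine hdel.sup_edge fun a b hab _ => Set.disjoint_left.2 fun w hw hw' => ?_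
  rw [SimpleGraph.deleteEdges_adj, Set.mem_singleton_iff] at hab
  obtain ⟨hab, hne⟩ := hab
  obtain ⟨h1, h2, -, -⟩ := h
  have hcdw := orient_eq_zero_of_mem_openSegment hw'
  -- The line `uv` cuts `cd` into a part in each clear triangle and one point of `uv`; only the
  -- deleted edge can pass there.
  rcases lt_trichotomy (orient (u : Plane) v w) 0 with h0 | h0 | h0
  · refine Set.disjoint_left.1 (hc a b hab) hw ?_
    obtain ⟨x, y, hx, hy, hxy, rfl⟩ := hw'
    refine ⟨by rw [orient_swap]; linarith, ?_, ?_⟩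
    · rw [orient_combo _ _ _ _ hxy, orient_self_right, ← orient_cycle]
      have := mul_pos hy h1
      linarith
    · rw [orient_combo _ _ _ _ hxy, orient_self_left, ← orient_cycle, ← orient_cycle, orient_swap]
      have := mul_neg_of_pos_of_neg hy h2
      linarith
  · exact hne (hT.eq_of_mem hab huv hw (mem_openSegment_of_orient h0 hcdw h1 h2))
  · refine Set.disjoint_left.1 (hd a b hab) hw ?_
    obtain ⟨x, y, hx, hy, hxy, rfl⟩ := hw'
    refine ⟨h0, ?_, ?_⟩
    · rw [orient_combo _ _ _ _ hxy, orient_self_right, orient_swap (d : Plane) v,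
        orient_cycle (c : Plane) d v]
      have := mul_neg_of_pos_of_neg hx h2
      linarith
    · rw [orient_combo _ _ _ _ hxy, orient_self_left, orient_cycle]
      have := mul_pos hx h1
      linarith

/-- A maximal biplane graph has no common flippable edge. -/
lemma IsMaximalBiplane.false_of_flip {G T₁ T₂ : SimpleGraph S} (hG : IsMaximalBiplane G)
    (hGT : G = T₁ ⊔ T₂) (h₁ : IsPlane T₁) (h₂ : IsPlane T₂) {u v c d : S}
    (huv₁ : T₁.Adj u v) (huv₂ : T₂.Adj u v) (h : Crosses (c : Plane) d u v)
    (hd : IsClear T₁ u v d) (hc : IsClear T₁ v u c) : False := by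
  have hcd : c ≠ d := by
    rintro rfl
    have := h.left
    simp [orient] at this
  have hle : G ≤ (T₁.deleteEdges {s(u, v)} ⊔ SimpleGraph.edge c d) ⊔ T₂ := by
    rw [hGT]
    intro a b hab
    rw [SimpleGraph.sup_adj] at hab
    rw [SimpleGraph.sup_adj, SimpleGraph.sup_adj, SimpleGraph.deleteEdges_adj,
      Set.mem_singleton_iff]
    by_cases hs : s(a, b) = s(u, v)
    · right
      rwa [← SimpleGraph.mem_edgeSet, hs, SimpleGraph.mem_edgeSet]
    · tauto
  have := hG.2 ((h₁.flip huv₁ h hd hc).isBiplane_sup h₂) hle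
  have hadj : G.Adj c d := this (by
    rw [SimpleGraph.sup_adj, SimpleGraph.sup_adj, SimpleGraph.edge_adj]
    exact Or.inl (Or.inr ⟨Or.inl ⟨rfl, rfl⟩, hcd⟩))
  rw [hGT, SimpleGraph.sup_adj] at hadj
  rcases hadj with hadj | hadj
  · exact h₁.not_crosses hadj huv₁ h
  · exact h₂.not_crosses hadj huv₂ h

/-- Enlarging each layer to a maximal plane graph keeps the union biplane, so maximality of `G`
leaves the union unchanged. -/
lemma IsMaximalBiplane.exists_maximal_isPlane {G : SimpleGraph S} (hG : IsMaximalBiplane G) :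
    ∃ T₁ T₂ : SimpleGraph S, Maximal IsPlane T₁ ∧ Maximal IsPlane T₂ ∧ G = T₁ ⊔ T₂ := by
  obtain ⟨G₁, G₂, h₁, h₂, -, hE⟩ := hG.1
  rw [← SimpleGraph.edgeSet_sup, SimpleGraph.edgeSet_inj] at hE
  obtain ⟨T₁, hle₁, hT₁⟩ := Finite.exists_le_maximal h₁
  obtain ⟨T₂, hle₂, hT₂⟩ := Finite.exists_le_maximal h₂
  refine ⟨T₁, T₂, hT₁, hT₂, ?_⟩
  have hle : G ≤ T₁ ⊔ T₂ := hE ▸ sup_le_sup hle₁ hle₂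
  exact le_antisymm hle (hG.2 (hT₁.1.isBiplane_sup hT₂.1) hle)

/-- No two vertices separate a maximal biplane graph. -/
lemma IsMaximalBiplane.exists_adj_of_cover (hS : GeneralPosition S) {G : SimpleGraph S}
    (hG : IsMaximalBiplane G) {A B X : Set S} (hcover : ∀ s, s ∈ A ∨ s ∈ B ∨ s ∈ X)
    (hdisj : Disjoint A B) (hX : ∀ x ∈ X, ∀ y ∈ X, ∀ z ∈ X, x ≠ y → z = x ∨ z = y)
    (hA : A.Nonempty) (hB : B.Nonempty) : ∃ a ∈ A, ∃ b ∈ B, G.Adj a b := by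
  by_contra! hAB
  obtain ⟨T₁, T₂, h₁, h₂, rfl⟩ := hG.exists_maximal_isPlane
  have hAB₁ : ∀ a ∈ A, ∀ b ∈ B, ¬ T₁.Adj a b := fun a ha b hb h => hAB a ha b hb (Or.inl h)
  have hAB₂ : ∀ a ∈ A, ∀ b ∈ B, ¬ T₂.Adj a b := fun a ha b hb h => hAB a ha b hb (Or.inr h)
  have hne : ∀ a ∈ A, ∀ b ∈ B, a ≠ b := by
    rintro a ha b hb rfl
    exact Set.disjoint_left.1 hdisj ha hb
  obtain ⟨a, ha⟩ := hA
  obtain ⟨b, hb⟩ := hB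
  obtain ⟨u, hu, v, hv, huv, -, ⟨c, hc, hvuc, hclc⟩, d, hd, huvd, hcld⟩ :=
    exists_crosses_separator hS h₁ hcover hX hAB₁ (hne a ha b hb) ha hb
  have hXuv : ∀ x ∈ X, ∀ y ∈ X, x ≠ y → s(u, v) = s(x, y) := by
    intro x hx y hy hxy
    rw [Sym2.eq_iff]
    rcases hX u hu v hv x hx huv.ne with rfl | rfl <;>
      rcases hX _ hu _ hv y hy huv.ne with rfl | rfl <;> simp at hxy ⊢
  obtain ⟨x, hx, y, hy, hxy, -⟩ :=
    exists_crosses_separator hS h₂ hcover hX hAB₂ (hne a ha b hb) ha hb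
  have huv₂ : T₂.Adj u v := by
    rwa [← SimpleGraph.mem_edgeSet, hXuv x hx y hy hxy.ne, SimpleGraph.mem_edgeSet]
  -- The original segment need not join the two apices. Starting again from `c` and `d` shows that
  -- `cd` itself crosses the only edge inside `X`.
  obtain ⟨x, hx, y, hy, hxy, hcr, -⟩ :=
    exists_crosses_separator hS h₁ hcover hX hAB₁ (hne c hc d hd) hc hd
  have : Crosses (c : Plane) d u v := by
    rcases Sym2.eq_iff.1 (hXuv x hx y hy hxy.ne) with ⟨rfl, rfl⟩ | ⟨rfl, rfl⟩
    · exact hcr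
    · have := hcr.ahead
      rw [orient_swap] at this
      linarith
  exact hG.false_of_flip rfl h₁.1 h₂.1 huv huv₂ this hcld hclc

lemma IsMaximalBiplane.isVertexConnected (hS : GeneralPosition S) {G : SimpleGraph S}
    (hG : IsMaximalBiplane G) (hcard : 4 ≤ S.card) : IsVertexConnected 3 G := by
  classical
  refine ⟨by rw [Fintype.card_coe]; omega, fun X hX => ?_⟩
  rw [SimpleGraph.connected_iff]
  constructor
  · intro a b
    by_contra hab
    -- The component of `a` after deleting `X`; `B` collects the other remaining vertices.
    let A : Set S := {s | ∃ h : s ∉ X, (G.induce {v : S | v ∉ X}).Reachable a ⟨s, h⟩}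
    let B : Set S := {s | s ∉ X ∧ s ∉ A}
    have hcover : ∀ s, s ∈ A ∨ s ∈ B ∨ s ∈ {s | s ∈ X} := by
      intro s
      by_cases h1 : s ∈ X
      · exact Or.inr (Or.inr h1)
      · by_cases h2 : s ∈ A
        · exact Or.inl h2
        · exact Or.inr (Or.inl ⟨h1, h2⟩)
    have hXX : ∀ x ∈ {s | s ∈ X}, ∀ y ∈ {s | s ∈ X}, ∀ z ∈ {s | s ∈ X},
        x ≠ y → z = x ∨ z = y := by
      intro x hx y hy z hz hxy
      by_contra! hcon
      have : ({x, y, z} : Finset S) ⊆ X := by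
        intro w hw
        simp only [Finset.mem_insert, Finset.mem_singleton] at hw
        rcases hw with rfl | rfl | rfl <;> assumption
      have h3 := Finset.card_le_card this
      rw [Finset.card_eq_three.2 ⟨x, y, z, hxy, hcon.1.symm, hcon.2.symm, rfl⟩] at h3
      omega
    obtain ⟨c, ⟨hcX, hc⟩, d, ⟨hdX, hd⟩, hcd⟩ := hG.exists_adj_of_cover hS hcover
      (Set.disjoint_left.2 fun s h1 h2 => h2.2 h1) hXX ⟨a, a.2, SimpleGraph.Reachable.refl _⟩
      ⟨b, b.2, fun h => hab h.2⟩
    exact hd ⟨hdX, hc.trans (SimpleGraph.Adj.reachable (by simpa using hcd))⟩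
  · by_contra hempty
    rw [not_nonempty_iff] at hempty
    have : X = Finset.univ := by
      ext v
      simp only [Finset.mem_univ, iff_true]
      by_contra hv
      exact hempty.false ⟨v, hv⟩
    rw [this, Finset.card_univ, Fintype.card_coe] at hX
    omega

/-! ### Triangular faces and flippable edges -/

lemma continuous_orient (a b : Plane) : Continuous (orient a b) := by
  unfold orient
  fun_prop

lemma isOpen_openTriangle (p q c : Plane) : IsOpen (openTriangle p q c) := by
  have h : ∀ a b : Plane, IsOpen {w | 0 < orient a b w} := fun a b =>
    isOpen_lt continuous_const (continuous_orient a b)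
  exact (h p q).inter ((h q c).inter (h c p))

lemma coord_cycle_eq {p q c : Plane} (w : Plane) :
    coord q c p w = orient q c w / orient p q c ∧ coord c p q w = orient c p w / orient p q c := by
  unfold coord
  rw [show orient q c p = orient p q c from orient_cycle p q c,
    show orient c p q = orient p q c from (orient_cycle c p q).symm]
  exact ⟨rfl, rfl⟩

lemma openTriangle_subset_interior {p q c : Plane} (h : 0 < orient p q c) :
    openTriangle p q c ⊆ interior (convexHull ℝ {p, q, c}) := by
  refine interior_maximal ?_ (isOpen_openTriangle p q c)
  rintro w ⟨h1, h2, h3⟩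
  have hbar := eq_barycentric h.ne' w
  have hsum := coord_sum h.ne' w
  obtain ⟨e1, e2⟩ := coord_cycle_eq (p := p) (q := q) (c := c) w
  have p1 : 0 ≤ coord q c p w := by rw [e1]; positivity
  have p2 : 0 ≤ coord c p q w := by rw [e2]; positivity
  have p3 : 0 ≤ coord p q c w := by unfold coord; positivity
  have := (convex_convexHull ℝ ({p, q, c} : Set Plane)).sum_mem (t := Finset.univ)
    (w := ![coord q c p w, coord c p q w, coord p q c w]) (z := ![p, q, c])
    (by intro i _; fin_cases i <;> simpa) (by simpa [Fin.sum_univ_three] using hsum)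
    (by intro i _; fin_cases i <;> exact subset_convexHull ℝ _ (by simp))
  simp only [Fin.sum_univ_three, Matrix.cons_val_zero, Matrix.cons_val_one, Matrix.cons_val] at this
  rwa [← hbar] at this

lemma orient_nonneg_of_mem_convexHull {p q c w : Plane} (h : 0 ≤ orient p q c)
    (hw : w ∈ convexHull ℝ {p, q, c}) : 0 ≤ orient p q w := by
  have hconv : Convex ℝ {w | 0 ≤ orient p q w} := by
    intro x hx y hy s t hs ht hst
    simp only [Set.mem_ofPred_eq] at hx hy ⊢
    rw [orient_combo _ _ _ _ hst]
    positivity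
  refine convexHull_min ?_ hconv hw
  rintro x (rfl | rfl | rfl)
  · exact (orient_self_left _ _).ge
  · exact (orient_self_right _ _).ge
  · exact h

lemma orient_nonneg_of_mem_convexHull' {p q c w : Plane} (h : 0 ≤ orient p q c)
    (hw : w ∈ convexHull ℝ {p, q, c}) :
    0 ≤ orient p q w ∧ 0 ≤ orient q c w ∧ 0 ≤ orient c p w := by
  have cyc : ∀ x y z : Plane, ({y, z, x} : Set Plane) = {x, y, z} := fun x y z => by
    rw [Set.insert_comm x, Set.pair_comm x]
  refine ⟨orient_nonneg_of_mem_convexHull h hw, ?_, ?_⟩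
  · exact orient_nonneg_of_mem_convexHull (c := p) (by rwa [orient_cycle]) (by rwa [cyc])
  · exact orient_nonneg_of_mem_convexHull (c := q) (by rwa [orient_cycle, orient_cycle])
      (by rwa [cyc, cyc])

/-- A point of the triangle `pqc` on the line `pq` belongs to the side `pq`. -/
lemma mem_segment_of_mem_convexHull {p q c w : Plane} (h : 0 < orient p q c)
    (hw : w ∈ convexHull ℝ {p, q, c}) (h0 : orient p q w = 0) : w ∈ segment ℝ p q := by
  obtain ⟨-, h2, h3⟩ := orient_nonneg_of_mem_convexHull' h.le hw
  have hbar := eq_barycentric h.ne' w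
  have hsum := coord_sum h.ne' w
  obtain ⟨e1, e2⟩ := coord_cycle_eq (p := p) (q := q) (c := c) w
  have e3 : coord p q c w = 0 := by unfold coord; rw [h0, zero_div]
  rw [e3] at hbar hsum
  refine ⟨coord q c p w, coord c p q w, by rw [e1]; positivity, by rw [e2]; positivity,
    by linarith, ?_⟩
  conv_rhs => rw [hbar]
  simp

/-- A frontier point is on the line of some side, and general position leaves only the ends of that
side. -/
lemma GeneralPosition.eq_vertex_of_mem_frontier (hS : GeneralPosition S) {p q r a : S}
    (h : 0 < orient (p : Plane) q r)
    (ha : (a : Plane) ∈ frontier (interior (convexHull ℝ {(p : Plane), (q : Plane), (r : Plane)}))) :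
    a = p ∨ a = q ∨ a = r := by
  have hcl : (a : Plane) ∈ convexHull ℝ {(p : Plane), (q : Plane), (r : Plane)} :=
    closure_minimal interior_subset
      (Set.Finite.isClosed_convexHull ℝ (Set.toFinite _)) (frontier_subset_closure ha)
  have hnot : (a : Plane) ∉ openTriangle (p : Plane) q r := fun h' => by
    rw [isOpen_interior.frontier_eq] at ha
    exact ha.2 (openTriangle_subset_interior h h')
  have hpq : p ≠ q := by rintro rfl; simp [orient] at h
  have hqr : q ≠ r := by rintro rfl; rw [orient_self_right] at h; exact lt_irrefl _ h
  have hrp : r ≠ p := by rintro rfl; rw [orient_self_left] at h; exact lt_irrefl _ h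
  obtain ⟨h1, h2, h3⟩ := orient_nonneg_of_mem_convexHull' h.le hcl
  by_contra! hne
  refine hnot ⟨lt_of_le_of_ne h1 fun h0 => ?_, lt_of_le_of_ne h2 fun h0 => ?_,
    lt_of_le_of_ne h3 fun h0 => ?_⟩
  · rcases hS.eq_or_eq hpq h0.symm with h | h
    · exact hne.1 h
    · exact hne.2.1 h
  · rcases hS.eq_or_eq hqr h0.symm with h | h
    · exact hne.2.1 h
    · exact hne.2.2 h
  · rcases hS.eq_or_eq hrp h0.symm with h | h
    · exact hne.2.2 h
    · exact hne.1 h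

/-- A bounded face adjacent to the edge `ab` is a triangle `abc`. -/
lemma IsTriangle.exists_apex (hS : GeneralPosition S) {T : SimpleGraph S} {F : Set Plane}
    (hF : IsTriangle T F) {a b : S} (hab : a ≠ b)
    (hfr : segment ℝ (a : Plane) b ⊆ frontier F) :
    ∃ c : S, c ≠ a ∧ c ≠ b ∧
      F = interior (convexHull ℝ {(a : Plane), (b : Plane), (c : Plane)}) := by
  obtain ⟨p, q, r, hpq, hqr, hpr, rfl⟩ := hF
  have vert : ∀ s : S, (s : Plane) ∈ segment ℝ (a : Plane) b → s = p ∨ s = q ∨ s = r := by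
    intro s hs
    rcases lt_or_gt_of_ne (hS.orient_ne_zero hpq.ne hpr.ne hqr.ne) with h | h
    · have := hS.eq_vertex_of_mem_frontier (p := q) (q := p) (r := r) (a := s)
        (by rw [orient_swap]; linarith) (by rw [Set.insert_comm]; exact hfr hs)
      tauto
    · exact hS.eq_vertex_of_mem_frontier h (hfr hs)
  have pq := hpq.ne
  have qr := hqr.ne
  have pr := hpr.ne
  rcases vert a (left_mem_segment _ _ _) with rfl | rfl | rfl <;>
    rcases vert b (right_mem_segment _ _ _) with rfl | rfl | rfl
  · exact absurd rfl hab
  · exact ⟨r, pr.symm, qr.symm, rfl⟩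
  · exact ⟨q, pq.symm, qr, by rw [Set.pair_comm]⟩
  · exact ⟨r, qr.symm, pr.symm, by rw [Set.insert_comm]⟩
  · exact absurd rfl hab
  · exact ⟨p, pq, pr, by rw [Set.insert_comm, Set.pair_comm (p : Plane)]⟩
  · exact ⟨q, qr, pq.symm, by rw [Set.pair_comm, Set.insert_comm]⟩
  · exact ⟨p, pr, pq, by
      rw [Set.pair_comm (b : Plane), Set.insert_comm, Set.pair_comm (p : Plane)]⟩
  · exact absurd rfl hab

lemma IsFace.disjoint_drawing {T : SimpleGraph S} {F : Set Plane} (hF : IsFace T F) :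
    Disjoint (drawing T) F := by
  obtain ⟨x, -, rfl⟩ := hF
  exact (Set.disjoint_compl_right_iff_subset.2
    (subset_refl _)).mono_right (connectedComponentIn_subset _ _)

lemma IsFace.eq_of_mem {T : SimpleGraph S} {F₁ F₂ : Set Plane} (h₁ : IsFace T F₁)
    (h₂ : IsFace T F₂) {w : Plane} (hw₁ : w ∈ F₁) (hw₂ : w ∈ F₂) : F₁ = F₂ := by
  obtain ⟨x, -, rfl⟩ := h₁
  obtain ⟨y, -, rfl⟩ := h₂
  rw [connectedComponentIn_eq hw₁, connectedComponentIn_eq hw₂]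

lemma IsFace.isClear {T : SimpleGraph S} {a b c : Plane} (h : 0 < orient a b c)
    (hF : IsFace T (interior (convexHull ℝ {a, b, c}))) : IsClear T a b c := by
  intro p q hpq
  refine hF.disjoint_drawing.mono ?_ (openTriangle_subset_interior h)
  exact fun x hx => Or.inr ⟨p, q, hpq, openSegment_subset_segment _ _ _ hx⟩

/-- Points just off the midpoint of `ab` towards `c` lie in both triangles. -/
lemma nonempty_openTriangle_inter {a b c d : Plane} (hc : 0 < orient a b c)
    (hd : 0 < orient a b d) : (openTriangle a b c ∩ openTriangle a b d).Nonempty := by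
  have hbca : 0 < orient b c a := by rwa [orient_cycle]
  have hcab : 0 < orient c a b := by rwa [orient_cycle, orient_cycle]
  have hbda : 0 < orient b d a := by rwa [orient_cycle]
  have hdab : 0 < orient d a b := by rwa [orient_cycle, orient_cycle]
  set m : Plane := (1 / 2 : ℝ) • a + (1 / 2 : ℝ) • b with hm
  have hhalf : (1 / 2 : ℝ) + 1 / 2 = 1 := by norm_num
  have hbd : 0 < orient b d m := by
    rw [hm, orient_combo _ _ _ _ hhalf, orient_self_left]; linarith
  have hda : 0 < orient d a m := by
    rw [hm, orient_combo _ _ _ _ hhalf, orient_self_right]; linarith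
  have hbc : 0 < orient b c m := by
    rw [hm, orient_combo _ _ _ _ hhalf, orient_self_left]; linarith
  have hca : 0 < orient c a m := by
    rw [hm, orient_combo _ _ _ _ hhalf, orient_self_right]; linarith
  have hab : orient a b m = 0 := by
    rw [hm, orient_combo _ _ _ _ hhalf, orient_self_left, orient_self_right]; ring
  have hev : ∀ᶠ ε in nhdsWithin (0 : ℝ) (Set.Ioi 0), ε < 1 ∧
      0 < (1 - ε) * orient b d m + ε * orient b d c ∧
      0 < (1 - ε) * orient d a m + ε * orient d a c := by
    apply nhdsWithin_le_nhds
    have c1 : Continuous fun ε : ℝ => (1 - ε) * orient b d m + ε * orient b d c := by fun_prop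
    have c2 : Continuous fun ε : ℝ => (1 - ε) * orient d a m + ε * orient d a c := by fun_prop
    filter_upwards [eventually_lt_nhds (zero_lt_one' ℝ),
      (c1.tendsto 0).eventually (eventually_gt_nhds (by simpa using hbd)),
      (c2.tendsto 0).eventually (eventually_gt_nhds (by simpa using hda))] with ε e1 e2 e3
    exact ⟨e1, e2, e3⟩
  obtain ⟨ε, ⟨e1, e2, e3⟩, e0⟩ := (hev.and self_mem_nhdsWithin).exists
  replace e0 : 0 < ε := e0
  have hε : 1 - ε + ε = 1 := by ring
  have hε' : 0 < 1 - ε := by linarith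
  refine ⟨(1 - ε) • m + ε • c, ⟨?_, ?_, ?_⟩, ?_, ?_, ?_⟩ <;> rw [orient_combo _ _ _ _ hε]
  · rw [hab]; have := mul_pos e0 hc; linarith
  · rw [orient_self_right]; have := mul_pos hε' hbc; linarith
  · rw [orient_self_left]; have := mul_pos hε' hca; linarith
  · rw [hab]; have := mul_pos e0 hc; linarith
  · exact e2
  · exact e3

lemma apex_mem_closure_interior {a b c : Plane} (h : 0 < orient a b c) :
    c ∈ closure (interior (convexHull ℝ {a, b, c})) := by
  obtain ⟨w, hw, -⟩ := nonempty_openTriangle_inter h h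
  rw [(convex_convexHull ℝ _).closure_interior_eq_closure_of_nonempty_interior
    ⟨w, openTriangle_subset_interior h hw⟩]
  exact subset_closure (subset_convexHull ℝ _ (by simp))

/-- The two triangles adjacent to a flippable edge `uv` have apices whose segment crosses `uv`. -/
lemma IsFlippable.exists_crosses (hS : GeneralPosition S) {T : SimpleGraph S}
    (hT : IsTriangulation T) {a b : S} (h : IsFlippable T a b) :
    ∃ u v c d : S, s(u, v) = s(a, b) ∧ Crosses (c : Plane) d u v ∧
      IsClear T u v d ∧ IsClear T v u c := by
  obtain ⟨hab, F₁, F₂, hF₁, hb₁, hfr₁, hF₂, hb₂, hfr₂, hne, p, -, hQ⟩ := h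
  obtain ⟨c, hca, hcb, rfl⟩ := (hT.bounded_face F₁ hF₁ hb₁).exists_apex hS hab.ne hfr₁
  obtain ⟨d, hda, hdb, rfl⟩ := (hT.bounded_face F₂ hF₂ hb₂).exists_apex hS hab.ne hfr₂
  have hconv : Convex ℝ (closure (interior (convexHull ℝ {(a : Plane), (b : Plane), (c : Plane)})) ∪
      closure (interior (convexHull ℝ {(a : Plane), (b : Plane), (d : Plane)}))) :=
    hQ ▸ convex_convexHull ℝ _
  clear hQ
  have main : ∀ u v : S, s(u, v) = s(a, b) →
      ({(u : Plane), (v : Plane), (c : Plane)} : Set Plane) = {(a : Plane), (b : Plane), (c : Plane)} →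
      ({(u : Plane), (v : Plane), (d : Plane)} : Set Plane) = {(a : Plane), (b : Plane), (d : Plane)} →
      0 < orient (v : Plane) u c → ∃ u v c d : S, s(u, v) = s(a, b) ∧
        Crosses (c : Plane) d u v ∧ IsClear T u v d ∧ IsClear T v u c := by
    intro u v huv hec hed hc
    rw [← hec] at hF₁ hne hconv
    rw [← hed] at hF₂ hne hconv
    have huv' : u ≠ v := by rintro rfl; simp [orient] at hc
    have hdu : d ≠ u ∧ d ≠ v := by
      rcases Sym2.eq_iff.1 huv with ⟨rfl, rfl⟩ | ⟨rfl, rfl⟩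
      · exact ⟨hda, hdb⟩
      · exact ⟨hdb, hda⟩
    -- With both apices on one side of `uv` the triangles would overlap, and overlapping faces
    -- coincide.
    have hd : 0 < orient (u : Plane) v d := by
      by_contra hd
      have hd' : 0 < orient (v : Plane) u d := by
        rw [orient_swap]
        have := hS.orient_ne_zero huv' hdu.1.symm hdu.2.symm
        have := lt_of_le_of_ne (not_lt.1 hd) this
        linarith
      obtain ⟨w, hw₁, hw₂⟩ := nonempty_openTriangle_inter hc hd'
      refine hne (hF₁.eq_of_mem hF₂ (w := w) ?_ ?_)
      · rw [Set.insert_comm]; exact openTriangle_subset_interior hc hw₁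
      · rw [Set.insert_comm]; exact openTriangle_subset_interior hd' hw₂
    have hc' : orient (u : Plane) v c < 0 := by rw [orient_swap] at hc; linarith
    have hcd : c ≠ d := by rintro rfl; linarith
    have hcmem : (c : Plane) ∈
        closure (interior (convexHull ℝ {(u : Plane), (v : Plane), (c : Plane)})) := by
      rw [Set.insert_comm]; exact apex_mem_closure_interior hc
    have hdmem := apex_mem_closure_interior hd
    have hden : 0 < orient (u : Plane) v d - orient (u : Plane) v c := by linarith
    obtain ⟨x, hx, hx0⟩ : ∃ x ∈ openSegment ℝ (c : Plane) d, orient (u : Plane) v x = 0 := by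
      refine ⟨_, ⟨orient (u : Plane) v d / (orient (u : Plane) v d - orient (u : Plane) v c),
        -orient (u : Plane) v c / (orient (u : Plane) v d - orient (u : Plane) v c),
        div_pos hd hden, div_pos (by linarith) hden, ?_, rfl⟩, ?_⟩
      · field_simp; ring
      · rw [orient_combo _ _ _ _ (by field_simp; ring)]
        field_simp
        ring
    have hcl : ∀ s : Set Plane, s.Finite → closure (interior (convexHull ℝ s)) ⊆ convexHull ℝ s :=
      fun s hs => closure_minimal interior_subset (hs.isClosed_convexHull ℝ)
    -- By convexity `cd` stays in the union of the two closed triangles, and each of these meets the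
    -- line `uv` only in the side `uv`.
    have hxs : x ∈ segment ℝ (u : Plane) v := by
      rcases hconv.segment_subset (Or.inl hcmem) (Or.inr hdmem)
        (openSegment_subset_segment _ _ _ hx) with h | h
      · have h' := hcl _ (Set.toFinite _) h
        rw [Set.insert_comm] at h'
        rw [segment_symm]
        exact mem_segment_of_mem_convexHull hc h' (by rw [orient_swap, hx0, neg_zero])
      · exact mem_segment_of_mem_convexHull hd (hcl _ (Set.toFinite _) h) hx0
    have hxo : x ∈ openSegment ℝ (u : Plane) v := by
      rcases eq_or_mem_openSegment hxs with rfl | rfl | h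
      · exact absurd hx (hS.notMem_openSegment hcd)
      · exact absurd hx (hS.notMem_openSegment hcd)
      · exact h
    have hsne : s(c, d) ≠ s(u, v) := by
      intro h
      rcases Sym2.eq_iff.1 h with ⟨-, h⟩ | ⟨-, h⟩
      · exact hdu.2 h
      · exact hdu.1 h
    refine ⟨u, v, c, d, huv, ?_, hF₂.isClear hd, ?_⟩
    · rcases hS.crosses_of_mem hcd huv' hsne hx hxo with h | h
      · exact h
      · have := h.ahead
        rw [orient_swap] at this
        linarith
    · rw [Set.insert_comm] at hF₁
      exact hF₁.isClear hc
  rcases lt_or_gt_of_ne (hS.orient_ne_zero hab.ne hca.symm hcb.symm) with h | h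
  · exact main a b rfl rfl rfl (by rw [orient_swap]; linarith)
  · exact main b a Sym2.eq_swap (Set.insert_comm _ _ _) (Set.insert_comm _ _ _) h

lemma IsMaximalBiplane.not_isFlippable (hS : GeneralPosition S) {G T₁ T₂ : SimpleGraph S}
    (hG : IsMaximalBiplane G) (hGT : G = T₁ ⊔ T₂) (h₁ : IsTriangulation T₁) (h₂ : IsPlane T₂)
    {a b : S} (hab : T₂.Adj a b) : ¬ IsFlippable T₁ a b := by
  intro h
  obtain ⟨u, v, c, d, huv, hcr, hd, hc⟩ := h.exists_crosses hS h₁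
  refine hG.false_of_flip hGT h₁.plane h₂ ?_ ?_ hcr hd hc
  · rw [← SimpleGraph.mem_edgeSet, huv]; exact h.1
  · rw [← SimpleGraph.mem_edgeSet, huv]; exact hab

end Biplane

theorem mainTheorem8 (S : Finset Biplane.Plane) (hS : Biplane.GeneralPosition S)
    (G : SimpleGraph S) (hG : Biplane.IsMaximalBiplane G) :
    (∀ T' T'' : SimpleGraph S, Biplane.IsTriangulation T' → Biplane.IsTriangulation T'' →
      G.edgeSet = T'.edgeSet ∪ T''.edgeSet →
      ∀ a b : S, s(a, b) ∈ T'.edgeSet ∩ T''.edgeSet →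
        ¬ Biplane.IsFlippable T' a b ∧ ¬ Biplane.IsFlippable T'' a b) ∧
    (4 ≤ S.card → Biplane.IsVertexConnected 3 G) := by
  refine ⟨fun T' T'' h' h'' hE a b hab => ?_, hG.isVertexConnected hS⟩
  rw [← SimpleGraph.edgeSet_sup, SimpleGraph.edgeSet_inj] at hE
  exact ⟨hG.not_isFlippable hS hE h' h''.plane hab.2,
    hG.not_isFlippable hS (hE.trans (sup_comm _ _)) h'' h'.plane hab.1⟩
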